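/- Conventions. Locally compact groups are Hausdorff and homomorphisms between them are continuous. Semidirect products are topological. A locally compact group is \emph{standard solvable} if it is topologically isomorphic to a semidirect product $U\rtimes A$ such that: (1) $A$ is a compactly generated locally compact abelian group; (2) $U=\prod_{i=1}^n U_i$ is a finite direct product, where each $U_i$ is normalized by $A$ and $U_i=\mathbb{U}_i(\mathbf{K}_i)$ for some unipotent algebraic group $\mathbb{U}_i$ over a nondiscrete locally compact field $\mathbf{K}_i$ of characteristic zero, $A$ acting $\mathbf{K}_i$-linearly on the vector space $U_i/[U_i,U_i]$; (3) for every $i$, the only $A$-equivariant $\mathbf{K}_i$-linear quotient of $U_i/[U_i,U_i]$ on which all elements of $A$ act with only eigenvalues of modulus one is $\{0\}$. A \emph{real triangulable} group is a topological group isomorphic to a closed connected group of real triangular matrices. A \emph{group of SOL type} is a semidirect product $(\mathbf{K}_1\times\mathbf{K}_2)\rtimes E$, where $\mathbf{K}_1,\mathbf{K}_2$ are nondiscrete locally compact fields of characteristic zero and $E$ is a closed subgroup of $\mathbf{K}_1^*\times\mathbf{K}_2^*$, acting by coordinatewise multiplication, that contains as a cocompact subgroup the cyclic group generated by some $(t_1,t_2)$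 with $|t_1|>1>|t_2|$. It is \emph{non-Archimedean} if both $\mathbf{K}_1$ and $\mathbf{K}_2$ are non-Archimedean. A locally compact group satisfies the \emph{SOL obstruction} (resp. \emph{non-Archimedean SOL obstruction}) if it admits a homomorphism with dense image to a group of SOL type (resp. a non-Archimedean group of SOL type). Let $G$ be a locally compact group generated by a compact subset $S$, let $F_S$ be the free group over the set $S$, with word length $|\cdot|$, and let $K$ be the kernel of the natural map $F_S\to G$. For $d\in\mathbf{N}$ let $R(d)=\{w\in K:|w|\le d\}$. The group $G$ is \emph{compactly presented} if for some such $S$ and some $d$, $K$ is generated by $R(d)$ as a normal subgroup of $F_S$. The area $\mathrm{area}_{R(d)}(w)\in\mathbf{N}\cup\{\infty\}$ of $w\in K$ is its word length with respect to the set of conjugates of elements of $R(d)$, and $\delta_{S,d}(n)=\max\big(\lfloor n/2\rfloor,\sup\{\mathrm{area}_{R(d)}(w):w\in K,\ |w|\le n\}\big)$. We say that $G$ has an \emph{at least exponential Dehn function} if $G$ is compactly generated and, for every compact generating subset $S$ and every $d$, there is an integer $C\ge 1$ such that $\exp(n)\le C\,\delta_{S,d}(Cn)+C$ for all $n\in\mathbf{N}$.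 (If $R(d)$ does not generate $K$ as a normal subgroup, then $\delta_{S,d}$ is eventually infinite and this holds automatically.) \textbf{Theorem.} Let $G$ be a standard solvable group or a real triangulable group. If $G$ satisfies the SOL obstruction, then $G$ has an at least exponential Dehn function. If $G$ satisfies the non-Archimedean SOL obstruction, then $G$ is not compactly presented. -/

import Mathlib

open scoped ENNReal

universe u v w

/-! ### Topological semidirect products -/

/-- The product topology on a semidirect product `N ⋊[φ] H`. -/
instance semidirectProductTopology {N H : Type*} [Group N] [Group H]
    [TopologicalSpace N] [TopologicalSpace H] (φ : H →* MulAut N) :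
    TopologicalSpace (N ⋊[φ] H) :=
  TopologicalSpace.induced (fun g => (g.left, g.right)) inferInstance

/-! ### Word length, area and Dehn functions -/

section Dehn

variable {G : Type*} [Group G]

/-- The (possibly infinite) word length of `w` with respect to a subset `X` of a group. -/
noncomputable def wordLength (X : Set G) (w : G) : ℕ∞ :=
  ⨅ l : {l : List G // (∀ x ∈ l, x ∈ X ∨ x⁻¹ ∈ X) ∧ l.prod = w}, (l.1.length : ℕ∞)

/-- The area of `w` with respect to `R`: its word length with respect to the union of the
conjugates of `R`. It is finite exactly on the normal subgroup generated by `R`. -/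
noncomputable def area (R : Set G) (w : G) : ℕ∞ :=
  wordLength (Group.conjugatesOfSet R) w

/-- The natural homomorphism from the free group over the abstract set `S` to `G`. -/
def freeProj (S : Set G) : FreeGroup S →* G :=
  FreeGroup.lift (fun s : S => (s : G))

open Classical in
/-- Length in the free group over `S`, that is, the number of letters of the reduced word. -/
noncomputable def freeLength {S : Set G} (w : FreeGroup S) : ℕ :=
  FreeGroup.norm w

/-- The null-homotopic words of length at most `d`. -/
def relators (S : Set G) (d : ℕ) : Set (FreeGroup S) :=
  {w | w ∈ (freeProj S).ker ∧ freeLength w ≤ d}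

/-- The Dehn function of `G` with respect to the generating set `S` and the set of all relators of
length at most `d`. If these do not generate the kernel of `freeProj S` as a normal subgroup, some
null-homotopic word has infinite area, and the function is eventually infinite. -/
noncomputable def dehnFunction (S : Set G) (d : ℕ) (n : ℕ) : ℕ∞ :=
  max ((n / 2 : ℕ) : ℕ∞)
    (⨆ w : {w : FreeGroup S // w ∈ (freeProj S).ker ∧ freeLength w ≤ n},
      area (relators S d) w.1)

end Dehn

/-- `f ≼ g`: there is `C ≥ 1` with `f n ≤ C * g (C * n) + C` for all `n`. -/
def BiAsymptoticallyBounded (f g : ℕ → ℝ≥0∞) : Prop :=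
  ∃ C : ℕ, 1 ≤ C ∧ ∀ n, f n ≤ C * g (C * n) + C

section Presentations

variable (G : Type*) [Group G] [TopologicalSpace G]

/-- `S` is a compact subset that generates `G` as an abstract group. -/
def IsCompactGeneratingSet {G : Type*} [Group G] [TopologicalSpace G] (S : Set G) : Prop :=
  IsCompact S ∧ Subgroup.closure S = ⊤

/-- Compactly generated topological groups. -/
def IsCompactlyGeneratedGroup : Prop := ∃ S : Set G, IsCompactGeneratingSet S

/-- Compactly presented groups: for some compact generating set `S` and some `d`, the kernel of
the free group over `S` onto `G` is generated as a normal subgroup by its elements of length at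
most `d`. -/
def IsCompactlyPresented : Prop :=
  ∃ S : Set G, IsCompactGeneratingSet S ∧
    ∃ d : ℕ, Subgroup.normalClosure (relators S d) = (freeProj S).ker

/-- `G` is compactly generated and its Dehn function is at least exponential, for every choice of
the compact generating set and of the length of the relators. This allows for groups that are not
compactly presented, whose Dehn function is by convention (eventually) infinite. -/
def HasAtLeastExponentialDehnFunction : Prop :=
  IsCompactlyGeneratedGroup G ∧
    ∀ S : Set G, IsCompactGeneratingSet S → ∀ d : ℕ,
      BiAsymptoticallyBounded (fun n => ENNReal.ofReal (Real.exp n))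
        (fun n => (dehnFunction S d n : ℝ≥0∞))

end Presentations

/-! ### Real triangulable groups -/

/-- A topological group isomorphic to a closed connected group of real (upper) triangular
matrices. -/
def IsRealTriangulable (G : Type*) [Group G] [TopologicalSpace G] : Prop :=
  ∃ (n : ℕ) (H : Subgroup (Matrix.GeneralLinearGroup (Fin n) ℝ)),
    IsClosed (H : Set (Matrix.GeneralLinearGroup (Fin n) ℝ)) ∧
    IsConnected (H : Set (Matrix.GeneralLinearGroup (Fin n) ℝ)) ∧
    (∀ g ∈ H, ∀ i j : Fin n, j < i → (g : Matrix (Fin n) (Fin n) ℝ) i j = 0) ∧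
    Nonempty (G ≃ₜ* H)

/-! ### Standard solvable groups -/

/-- `H` is the group of `K`-points of a unipotent algebraic group, realized as a Zariski closed
subgroup of the group of upper unitriangular matrices. -/
def IsUnipotentAlgebraic {K : Type*} [Field K] {m : ℕ}
    (H : Subgroup (Matrix.GeneralLinearGroup (Fin m) K)) : Prop :=
  (∀ g ∈ H, ∀ i j : Fin m, j ≤ i →
    (g : Matrix (Fin m) (Fin m) K) i j = if i = j then 1 else 0) ∧
  ∃ P : Set (MvPolynomial (Fin m × Fin m) K), ∀ g : Matrix.GeneralLinearGroup (Fin m) K,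
    g ∈ H ↔ ∀ p ∈ P,
      MvPolynomial.eval (fun ij => (g : Matrix (Fin m) (Fin m) K) ij.1 ij.2) p = 0

/-- All eigenvalues of the endomorphism `T`, in all normed extension fields of `K`, have modulus
one. (The absolute value of a complete field `K` extends uniquely to an algebraic closure
of `K`.) -/
def HasOnlyModulusOneEigenvalues {K : Type u} [NontriviallyNormedField K] {V : Type*}
    [AddCommGroup V] [Module K V] [FiniteDimensional K V] (T : V →ₗ[K] V) : Prop :=
  ∀ (L : Type u) [NormedField L] [NormedAlgebra K L] (μ : L),
    Polynomial.aeval μ T.charpoly = 0 → ‖μ‖ = 1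

/-- `V₀ = 0`: the only `A`-equivariant quotient `V ⧸ W` on which `A` acts with only eigenvalues of
modulus one is the zero quotient. -/
def HasNoModulusOneQuotient {K : Type*} [NontriviallyNormedField K] {A : Type*} [Monoid A]
    {V : Type*} [AddCommGroup V] [Module K V] [FiniteDimensional K V]
    (ρ : Representation K A V) : Prop :=
  ∀ (W : Submodule K V) (hW : ∀ a, W ≤ W.comap (ρ a)),
    (∀ a, HasOnlyModulusOneEigenvalues (W.mapQ W (ρ a) (hW a))) → W = ⊤

/-- The action by automorphisms on a product of groups obtained from an action on each factor. -/
def piAction {ι A : Type*} [Group A] {U : ι → Type*} [∀ i, Group (U i)]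
    (φ : ∀ i, A →* MulAut (U i)) : A →* MulAut (∀ i, U i) where
  toFun a := MulEquiv.piCongrRight (fun i => φ i a)
  map_one' := by ext u i; simp
  map_mul' a b := by ext u i; simp

/-- A decomposition of the topological group `G` as a semidirect product `(∏ i, U i) ⋊ A`
exhibiting it as a standard solvable group. -/
structure StandardSolvableDecomposition (G : Type v) [Group G] [TopologicalSpace G] where
  /-- The acting group: a compactly generated locally compact abelian group. -/
  A : Type v
  [commGroup : CommGroup A]
  [topology : TopologicalSpace A]
  [topologicalGroup : IsTopologicalGroup A]
  [t2 : T2Space A]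
  [locallyCompact : LocallyCompactSpace A]
  compactlyGenerated : IsCompactlyGeneratedGroup A
  /-- The number of factors. -/
  n : ℕ
  /-- The nondiscrete locally compact fields of characteristic zero. -/
  K : Fin n → Type u
  [normedField : ∀ i, NontriviallyNormedField (K i)]
  [locallyCompactField : ∀ i, LocallyCompactSpace (K i)]
  [charZero : ∀ i, CharZero (K i)]
  /-- The sizes of the matrices. -/
  m : Fin n → ℕ
  /-- The unipotent groups. -/
  U : ∀ i, Subgroup (Matrix.GeneralLinearGroup (Fin (m i)) (K i))
  unipotent : ∀ i, IsUnipotentAlgebraic (U i)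
  /-- The action of `A` on each factor. -/
  φ : ∀ i, A →* MulAut (U i)
  continuous_action : ∀ i, Continuous (fun p : A × U i => φ i p.1 p.2)
  /-- The isomorphism with the semidirect product. -/
  e : G ≃* (∀ i, U i) ⋊[piAction φ] A
  isHomeomorph : IsHomeomorph e
  /-- The dimension of the abelianization of `U i`. -/
  r : Fin n → ℕ
  /-- The projection of `U i` onto its abelianization `U i / [U i, U i]`, which is identified, as
  a topological group, with the `K i`-vector space `K i ^ r i`. -/
  π : ∀ i, U i →* Multiplicative (Fin (r i) → K i)
  π_continuous : ∀ i, Continuous (π i)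
  π_surjective : ∀ i, Function.Surjective (π i)
  π_ker : ∀ i, (π i).ker = commutator (U i)
  /-- The linear action of `A` on the abelianization of `U i`. -/
  ρ : ∀ i, Representation (K i) A (Fin (r i) → K i)
  π_equivariant : ∀ i a u, (π i (φ i a u)).toAdd = ρ i a (π i u).toAdd
  no_modulus_one_quotient : ∀ i, HasNoModulusOneQuotient (ρ i)

/-- Standard solvable groups. -/
def IsStandardSolvable (G : Type v) [Group G] [TopologicalSpace G] : Prop :=
  Nonempty (StandardSolvableDecomposition.{u, v} G)

/-! ### Groups of SOL type -/

section SOL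

variable {K₁ K₂ : Type*}

/-- The action of a group `E` of pairs of nonzero scalars on the additive group `K₁ × K₂` by
`(a, b) • (x, y) = (a x, b y)`. -/
def solAction [Field K₁] [Field K₂] (E : Subgroup (K₁ˣ × K₂ˣ)) :
    E →* MulAut (Multiplicative (K₁ × K₂)) where
  toFun e :=
    { toFun := fun v =>
        Multiplicative.ofAdd ((e.1.1 : K₁) * v.toAdd.1, (e.1.2 : K₂) * v.toAdd.2)
      invFun := fun v => Multiplicative.ofAdd
        (((e.1.1⁻¹ : K₁ˣ) : K₁) * v.toAdd.1, ((e.1.2⁻¹ : K₂ˣ) : K₂) * v.toAdd.2)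
      left_inv := fun v => by simp
      right_inv := fun v => by simp
      map_mul' := fun v w => by simp [mul_add, ← ofAdd_add] }
  map_one' := by ext v <;> simp
  map_mul' e f := by ext v <;> simp [mul_assoc]

/-- The group `(K₁ × K₂) ⋊ E`. -/
abbrev SOLGroup [Field K₁] [Field K₂] (E : Subgroup (K₁ˣ × K₂ˣ)) : Type _ :=
  Multiplicative (K₁ × K₂) ⋊[solAction E] E

/-- The condition on `E` for `(K₁ × K₂) ⋊ E` to be of SOL type: `E` is closed and contains, as a
cocompact subgroup, the cyclic group generated by some `(t₁, t₂)` with `|t₁| > 1 > |t₂|`. -/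
def IsSOLType [NontriviallyNormedField K₁] [NontriviallyNormedField K₂]
    (E : Subgroup (K₁ˣ × K₂ˣ)) : Prop :=
  IsClosed (E : Set (K₁ˣ × K₂ˣ)) ∧
    ∃ t ∈ E, 1 < ‖(t.1 : K₁)‖ ∧ ‖(t.2 : K₂)‖ < 1 ∧
      CompactSpace (E ⧸ (Subgroup.zpowers t).subgroupOf E)

end SOL

/-- `G` admits a continuous homomorphism with dense image to a group of SOL type. -/
def HasSOLObstruction (G : Type v) [Group G] [TopologicalSpace G] : Prop :=
  ∃ (K₁ K₂ : Type u) (_ : NontriviallyNormedField K₁) (_ : NontriviallyNormedField K₂)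
    (_ : LocallyCompactSpace K₁) (_ : LocallyCompactSpace K₂) (_ : CharZero K₁) (_ : CharZero K₂)
    (E : Subgroup (K₁ˣ × K₂ˣ)) (f : G →* SOLGroup E),
    IsSOLType E ∧ Continuous f ∧ DenseRange f

/-- `G` admits a continuous homomorphism with dense image to a non-Archimedean group of SOL type,
that is, one for which both fields are non-Archimedean. -/
def HasNonArchimedeanSOLObstruction (G : Type v) [Group G] [TopologicalSpace G] : Prop :=
  ∃ (K₁ K₂ : Type u) (_ : NontriviallyNormedField K₁) (_ : NontriviallyNormedField K₂)
    (_ : LocallyCompactSpace K₁) (_ : LocallyCompactSpace K₂) (_ : CharZero K₁) (_ : CharZero K₂)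
    (_ : IsUltrametricDist K₁) (_ : IsUltrametricDist K₂)
    (E : Subgroup (K₁ˣ × K₂ˣ)) (f : G →* SOLGroup E),
    IsSOLType E ∧ Continuous f ∧ DenseRange f

/-! A homomorphism to a group of SOL type makes `G` act by affine maps on `K₁` and `K₂`. Let `h` be
the logarithm of the modulus of the first linear part (the height) and `X`, `Y` the translation
parts. The commutator subgroup `N` is nilpotent; `h` vanishes on it and `(X, Y)` is additive on it.
Take `τ` expanding `K₁` and contracting `K₂`, and `α` in `N` with `X α`, `Y α` nonzero. Then `τ^n α
τ^-n` is exponentially large in `K₁`, and `τ^-n α τ^n` in `K₂`. Both lie in `N`, so a `k`-fold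
iterated commutator of them is trivial, with `k` independent of `n`: this gives null-homotopic words
of length linear in `n`.

Their area is bounded below by a discrete cochain. For a test function `f` on `K₁ × K₂`, sum the
values of `f (X, Y)`, with sign, where a path crosses height `0`. If `f` varies by at most `ε` along
a generator near height `0`, every translate of a bounded relator has sum `O(ε)`
(`crossesAtStart_mk`), so a word of area `a` has sum `O(aε)`. Up to `O(nε)`, the upper conjugate
contributes nothing and the lower one contributes the difference of `f` at its endpoints; the
iterated commutator therefore gives an iterated difference of `f`, equal to `±1` when `f 0 = 1` and
`f` vanishes at the other, exponentially distant points (`exists_relator_of_testFunction`). Tent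
functions of exponentially large radius make `ε` exponentially small, whence exponential area. Over
ultrametric fields, indicators of balls give `ε = 0`, so no finite product of conjugates of bounded
relators equals the word.

It remains to see that `G` is compactly generated. For a standard solvable group, nilpotency reduces
this to the abelianizations, where an invariant open subgroup is the whole space because no nonzero
quotient has only eigenvalues of modulus one. A real triangulable group is connected and locally
compact. -/

open scoped commutatorElement

/-! ### Nilpotent groups and unitriangular matrices. -/

section Nilpotency

/-- In a nilpotent group, a subgroup that generates the group modulo the commutator subgroup is the
whole group. -/
theorem Subgroup.eq_top_of_sup_commutator_eq_top {N : Type*} [Group N] [Group.IsNilpotent N]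
    (H : Subgroup N) (hH : H ⊔ _root_.commutator N = ⊤) : H = ⊤ := by
  revert H
  refine Group.nilpotent_center_quotient_ind
    (P := fun N _ _ => ∀ H : Subgroup N, H ⊔ _root_.commutator N = ⊤ → H = ⊤) N
    (fun N _ _ H _ => Subsingleton.elim _ _) ?_
  intro N _ _ ih H hH
  have hq : Function.Surjective (QuotientGroup.mk' (Subgroup.center N)) :=
    QuotientGroup.mk'_surjective _
  have h1 : H.map (QuotientGroup.mk' (Subgroup.center N)) = ⊤ := by
    apply ih
    have := congrArg (Subgroup.map (QuotientGroup.mk' (Subgroup.center N))) hH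
    rw [Subgroup.map_sup, Subgroup.map_top_of_surjective _ hq, _root_.commutator_def,
      Subgroup.map_commutator, Subgroup.map_top_of_surjective _ hq] at this
    exact this
  have h2 : ∀ x : N, ∃ y ∈ H, ∃ z ∈ Subgroup.center N, x = y * z := by
    intro x
    have : (QuotientGroup.mk' (Subgroup.center N)) x ∈ H.map (QuotientGroup.mk' _) := by
      rw [h1]; trivial
    obtain ⟨y, hy, hyx⟩ := this
    exact ⟨y, hy, y⁻¹ * x, QuotientGroup.eq.1 hyx, by group⟩
  -- By induction `N` is `H` times its center, and central factors disappear from commutators, so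
  -- all commutators of `N` already lie in `H`.
  have h3 : _root_.commutator N ≤ H := by
    rw [_root_.commutator_def, Subgroup.commutator_le]
    intro x _ x' _
    obtain ⟨y, hy, z, hz, rfl⟩ := h2 x
    obtain ⟨y', hy', z', hz', rfl⟩ := h2 x'
    rw [Subgroup.mem_center_iff] at hz hz'
    have : ⁅y * z, y' * z'⁆ = ⁅y, y'⁆ := by
      simp only [commutatorElement_def, mul_inv_rev]
      calc y * z * (y' * z') * (z⁻¹ * y⁻¹) * (z'⁻¹ * y'⁻¹)
          = y * (z * y' * z') * z⁻¹ * y⁻¹ * z'⁻¹ * y'⁻¹ := by group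
        _ = y * (y' * z * z') * z⁻¹ * y⁻¹ * z'⁻¹ * y'⁻¹ := by rw [hz y']
        _ = y * y' * (z * z') * z⁻¹ * y⁻¹ * z'⁻¹ * y'⁻¹ := by group
        _ = y * y' * (z' * z) * z⁻¹ * y⁻¹ * z'⁻¹ * y'⁻¹ := by rw [hz' z]
        _ = y * y' * (z' * y⁻¹) * z'⁻¹ * y'⁻¹ := by group
        _ = y * y' * (y⁻¹ * z') * z'⁻¹ * y'⁻¹ := by rw [hz' y⁻¹]
        _ = y * y' * y⁻¹ * y'⁻¹ := by group
    rw [this]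
    exact H.mul_mem (H.mul_mem (H.mul_mem hy hy') (H.inv_mem hy)) (H.inv_mem hy')
  rwa [sup_eq_left.2 h3] at hH

variable {R : Type*} [Field R] {m : ℕ}

/-- The matrix `M` is concentrated on the diagonals of index at least `k` above the main one. -/
def Matrix.IsAboveDiagonal (k : ℕ) (M : Matrix (Fin m) (Fin m) R) : Prop :=
  ∀ i j : Fin m, (j : ℕ) < i + k → M i j = 0

theorem Matrix.IsAboveDiagonal.mul {k l : ℕ} {M N : Matrix (Fin m) (Fin m) R}
    (hM : M.IsAboveDiagonal k) (hN : N.IsAboveDiagonal l) : (M * N).IsAboveDiagonal (k + l) := by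
  intro i j hij
  rw [Matrix.mul_apply]
  refine Finset.sum_eq_zero fun p _ => ?_
  by_cases h : (p : ℕ) < i + k
  · rw [hM i p h, zero_mul]
  · rw [hN p j (by omega), mul_zero]

theorem Matrix.IsAboveDiagonal.sub {k : ℕ} {M N : Matrix (Fin m) (Fin m) R}
    (hM : M.IsAboveDiagonal k) (hN : N.IsAboveDiagonal k) : (M - N).IsAboveDiagonal k := by
  intro i j hij
  rw [Matrix.sub_apply, hM i j hij, hN i j hij, sub_zero]

theorem Matrix.IsAboveDiagonal.add {k : ℕ} {M N : Matrix (Fin m) (Fin m) R}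
    (hM : M.IsAboveDiagonal k) (hN : N.IsAboveDiagonal k) : (M + N).IsAboveDiagonal k := by
  intro i j hij
  rw [Matrix.add_apply, hM i j hij, hN i j hij, add_zero]

theorem Matrix.IsAboveDiagonal.neg {k : ℕ} {M : Matrix (Fin m) (Fin m) R}
    (hM : M.IsAboveDiagonal k) : (-M).IsAboveDiagonal k := by
  intro i j hij
  rw [Matrix.neg_apply, hM i j hij, neg_zero]

/-- The matrix `M` is upper unitriangular. -/
def Matrix.IsUnitriangular (M : Matrix (Fin m) (Fin m) R) : Prop :=
  ∀ i j : Fin m, j ≤ i → M i j = if i = j then 1 else 0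

theorem Matrix.IsUnitriangular.sub_one {M : Matrix (Fin m) (Fin m) R} (hM : M.IsUnitriangular) :
    (M - 1).IsAboveDiagonal 1 := by
  intro i j hij
  rw [Matrix.sub_apply, hM i j (by rw [Fin.le_def]; omega), Matrix.one_apply, sub_self]

theorem Matrix.IsUnitriangular.isAboveDiagonal {M : Matrix (Fin m) (Fin m) R}
    (hM : M.IsUnitriangular) : M.IsAboveDiagonal 0 := by
  intro i j hij
  have hij : j < i := by rw [Fin.lt_def]; omega
  rw [hM i j hij.le, if_neg hij.ne']

/-- The difference `gh - hg` is the additive commutator of `g - 1` and `h - 1`, whose diagonal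
indices `1` and `k` add up; the factor `g⁻¹h⁻¹` is upper triangular and does no harm. -/
theorem Matrix.IsAboveDiagonal.commutator_sub_one {k : ℕ}
    {g h : Matrix.GeneralLinearGroup (Fin m) R}
    (hg : g.1.IsUnitriangular) (hg' : (g⁻¹).1.IsUnitriangular) (hh' : (h⁻¹).1.IsUnitriangular)
    (hh : (h.1 - 1).IsAboveDiagonal k) : ((⁅g, h⁆).1 - 1).IsAboveDiagonal (k + 1) := by
  have e : (⁅g, h⁆).1 - 1 =
      ((g.1 - 1) * (h.1 - 1) - (h.1 - 1) * (g.1 - 1)) * ((g⁻¹).1 * (h⁻¹).1) := by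
    have h1 : (h * g) * (g⁻¹ * h⁻¹) = 1 := by group
    have h2 : h.1 * g.1 * ((g⁻¹).1 * (h⁻¹).1) = 1 := by
      have := congrArg Units.val h1
      simpa only [Units.val_mul, Units.val_one] using this
    calc (⁅g, h⁆).1 - 1 = g.1 * h.1 * ((g⁻¹).1 * (h⁻¹).1) - h.1 * g.1 * ((g⁻¹).1 * (h⁻¹).1) := by
          rw [h2, commutatorElement_def]
          simp only [Units.val_mul, mul_assoc]
      _ = _ := by noncomm_ring
  rw [e]
  have h3 := ((hg.sub_one.mul hh).sub (by simpa only [add_comm] using hh.mul hg.sub_one)).mul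
    (hg'.isAboveDiagonal.mul hh'.isAboveDiagonal)
  intro i j hij
  exact h3 i j (by omega)

/-- The elements of a group of unitriangular matrices that agree with the identity up to the
diagonal of index `k`. -/
def Subgroup.unitriangularSeries (H : Subgroup (Matrix.GeneralLinearGroup (Fin m) R))
    (hH : ∀ g ∈ H, g.1.IsUnitriangular) (k : ℕ) : Subgroup H where
  carrier := {g | (g.1.1 - 1).IsAboveDiagonal k}
  one_mem' := fun i j _ => by simp
  mul_mem' := by
    intro g h hg hh
    have e : (g * h).1.1 - 1 = (g.1.1 - 1) * h.1.1 + (h.1.1 - 1) := by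
      rw [Subgroup.coe_mul, Units.val_mul]; noncomm_ring
    rw [Set.mem_ofPred_eq, e]
    exact (hg.mul (hH h h.2).isAboveDiagonal).add hh
  inv_mem' := by
    intro g hg
    have e : (g⁻¹).1.1 - 1 = -((g.1.1 - 1) * (g⁻¹).1.1) := by
      have : g.1.1 * (g⁻¹).1.1 = 1 := by
        rw [Subgroup.coe_inv, Units.mul_inv]
      rw [sub_mul, this, one_mul, neg_sub]
    rw [Set.mem_ofPred_eq, e]
    exact (hg.mul (hH _ (g⁻¹).2).isAboveDiagonal).neg

/-- A group of unitriangular matrices is nilpotent. -/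
theorem Subgroup.isNilpotent_of_isUnitriangular {H : Subgroup (Matrix.GeneralLinearGroup (Fin m) R)}
    (hH : ∀ g ∈ H, g.1.IsUnitriangular) : Group.IsNilpotent H := by
  rw [Subgroup.nilpotent_iff_finite_descending_central_series]
  refine ⟨m + 1, H.unitriangularSeries hH, ⟨?_, ?_⟩, ?_⟩
  · exact (Subgroup.eq_top_iff' _).2 fun g i j hij => by
      rw [Matrix.sub_apply, hH g g.2 i j (by rw [Fin.le_def]; omega), Matrix.one_apply, sub_self]
  · intro x k hx g
    rw [← inv_mem_iff, commutatorElement_inv]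
    exact Matrix.IsAboveDiagonal.commutator_sub_one (hH g g.2) (hH _ (g⁻¹).2) (hH _ (x⁻¹).2) hx
  · refine (Subgroup.eq_bot_iff_forall _).2 fun g hg => ?_
    have : g.1.1 - 1 = 0 := by
      ext i j
      exact hg i j (by omega)
    exact Subtype.ext (Units.ext (sub_eq_zero.1 this))

/-- In a nilpotent subgroup, long iterated commutators are trivial. -/
theorem Subgroup.exists_iterate_commutator_eq_one {N : Type*} [Group N] (H : Subgroup N)
    [Group.IsNilpotent H] : ∃ k, ∀ x ∈ H, ∀ y ∈ H, (fun z => ⁅x, z⁆)^[k] y = 1 := by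
  obtain ⟨k, hk⟩ := (Subgroup.isNilpotent_iff_lowerCentralSeries H).1 ‹Group.IsNilpotent H›
  refine ⟨k, fun x hx y hy => ?_⟩
  rw [← Subgroup.mem_bot, ← hk]
  clear hk
  induction k with
  | zero => exact hy
  | succ k ih =>
    rw [Function.iterate_succ_apply', ← inv_mem_iff, commutatorElement_inv]
    exact Subgroup.commutator_mem_commutator ih hx

end Nilpotency

/-! ### Eigenvalues of modulus one and invariant open subgroups. -/

section ModulusOne

/-- On an eigenvector the powers of `t` act by `μ ^ n`, which would be unbounded if `‖μ‖ > 1`. -/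
theorem norm_le_one_of_mulVec_eq_smul {L : Type*} [NormedField L] {q : ℕ} {C : ℝ}
    {t : Matrix (Fin q) (Fin q) L} (hC : ∀ (n : ℕ) i j, ‖(t ^ n) i j‖ ≤ C) {x : Fin q → L}
    (hx : x ≠ 0) {μ : L} (ht : t.mulVec x = μ • x) : ‖μ‖ ≤ 1 := by
  by_contra! hμ
  have hn : ∀ n : ℕ, (t ^ n).mulVec x = μ ^ n • x := by
    intro n
    induction n with
    | zero => simp
    | succ n ih => rw [pow_succ, ← Matrix.mulVec_mulVec, ht, Matrix.mulVec_smul, ih, smul_smul, pow_succ,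
        mul_comm]
  obtain ⟨i, hi⟩ := Function.ne_iff.1 hx
  have hi0 : 0 < ‖x i‖ := norm_pos_iff.2 hi
  obtain ⟨n, hlt⟩ := pow_unbounded_of_one_lt ((∑ j, C * ‖x j‖) / ‖x i‖) hμ
  rw [div_lt_iff₀ hi0] at hlt
  have := congrFun (hn n) i
  rw [Pi.smul_apply, smul_eq_mul] at this
  rw [← norm_pow, ← norm_mul, ← this] at hlt
  refine hlt.not_ge ?_
  rw [Matrix.mulVec_eq_sum, Finset.sum_apply]
  refine (norm_sum_le _ _).trans (Finset.sum_le_sum fun j _ => ?_)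
  rw [Pi.smul_apply, Matrix.transpose_apply, op_smul_eq_mul, norm_mul]
  exact mul_le_mul_of_nonneg_right (hC n i j) (norm_nonneg _)

/-- An automorphism all of whose powers have bounded entries only has eigenvalues of modulus one. -/
theorem hasOnlyModulusOneEigenvalues_of_bounded {K : Type u} [NontriviallyNormedField K]
    {V : Type*} [AddCommGroup V] [Module K V] [FiniteDimensional K V] {q : ℕ}
    (b : Module.Basis (Fin q) K V) {T T' : V →ₗ[K] V} (hTT' : T' * T = 1) {C : ℝ}
    (hT : ∀ (n : ℕ) i j, ‖LinearMap.toMatrix b b (T ^ n) i j‖ ≤ C)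
    (hT' : ∀ (n : ℕ) i j, ‖LinearMap.toMatrix b b (T' ^ n) i j‖ ≤ C) :
    HasOnlyModulusOneEigenvalues T := by
  intro L _ _ μ hμ
  set t := (LinearMap.toMatrix b b T).map (algebraMap K L) with ht
  set t' := (LinearMap.toMatrix b b T').map (algebraMap K L) with ht'
  have hpow : ∀ (R : V →ₗ[K] V), (∀ (n : ℕ) i j, ‖LinearMap.toMatrix b b (R ^ n) i j‖ ≤ C) →
      ∀ (n : ℕ) i j, ‖(((LinearMap.toMatrix b b R).map (algebraMap K L)) ^ n) i j‖ ≤ C := by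
    intro R hR n i j
    have e : ((LinearMap.toMatrix b b R).map (algebraMap K L)) ^ n =
        (LinearMap.toMatrix b b (R ^ n)).map (algebraMap K L) := by
      rw [← LinearMap.toMatrix_pow]
      exact (map_pow (algebraMap K L).mapMatrix _ n).symm
    rw [e, Matrix.map_apply, norm_algebraMap']
    exact hR n i j
  have hdet : (Matrix.scalar (Fin q) μ - t).det = 0 := by
    rw [← Matrix.eval_charpoly, ht, Matrix.charpoly_map, LinearMap.charpoly_toMatrix,
      Polynomial.eval_map_algebraMap, hμ]
  obtain ⟨x, hx, hx0⟩ := Matrix.exists_mulVec_eq_zero_iff.2 hdet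
  have htx : t.mulVec x = μ • x := by
    rw [Matrix.sub_mulVec, sub_eq_zero] at hx0
    rw [← hx0]
    ext i
    simp [Matrix.scalar_apply, Matrix.mulVec_diagonal]
  have htt' : t' * t = 1 := by
    rw [ht, ht', ← Matrix.map_mul, ← LinearMap.toMatrix_mul, hTT', LinearMap.toMatrix_one]
    simp
  have hμx : μ • t'.mulVec x = x := by
    rw [← Matrix.mulVec_smul, ← htx, Matrix.mulVec_mulVec, htt', Matrix.one_mulVec]
  have hμ0 : μ ≠ 0 := by
    rintro rfl
    rw [zero_smul] at hμx
    exact hx hμx.symm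
  have htx' : t'.mulVec x = μ⁻¹ • x := by
    rw [eq_inv_smul_iff₀ hμ0, hμx]
  have h1 := norm_le_one_of_mulVec_eq_smul (hpow T hT) hx htx
  have h2 := norm_le_one_of_mulVec_eq_smul (hpow T' hT') hx htx'
  rw [norm_inv] at h2
  exact le_antisymm h1 ((inv_le_one₀ (norm_pos_iff.2 hμ0)).1 h2)

variable {K : Type u} [NontriviallyNormedField K]

/-- The largest linear subspace contained in an additive subgroup. -/
def AddSubgroup.linearPart {V : Type*} [AddCommGroup V] [Module K V] (M : AddSubgroup V) :
    Submodule K V where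
  carrier := {v | ∀ k : K, k • v ∈ M}
  zero_mem' k := by rw [smul_zero]; exact M.zero_mem
  add_mem' hv hw k := by rw [smul_add]; exact M.add_mem (hv k) (hw k)
  smul_mem' c v hv k := by rw [smul_smul]; exact hv _

/-- An open subgroup of `K ^ q` that is stable under scalars of modulus at most one and contains no
line is bounded. -/
theorem AddSubgroup.exists_norm_le_of_isOpen [LocallyCompactSpace K] {q : ℕ}
    {M : AddSubgroup (Fin q → K)} (hM : IsOpen (M : Set (Fin q → K)))
    (hsmul : ∀ k : K, ‖k‖ ≤ 1 → ∀ v ∈ M, k • v ∈ M) (hline : ∀ v, (∀ k : K, k • v ∈ M) → v = 0) :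
    ∃ R, ∀ v ∈ M, ‖v‖ ≤ R := by
  have : ProperSpace K := ProperSpace.of_locallyCompactSpace K
  obtain ⟨c, hc⟩ := NormedField.exists_one_lt_norm K
  have hc0 : 0 < ‖c‖ := zero_lt_one.trans hc
  have hcl : IsClosed (M : Set (Fin q → K)) := AddSubgroup.isClosed_of_isOpen M hM
  have hcpt : IsCompact (Metric.closedBall (0 : Fin q → K) 1 ∩ {v | 1 / ‖c‖ ≤ ‖v‖}) :=
    (isCompact_closedBall _ _).inter_right (isClosed_le continuous_const continuous_norm)
  -- Every vector of the compact shell leaves `M` after multiplication by some scalar, and this is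
  -- an open condition since open subgroups are closed. Finitely many scalars suffice, and `R`
  -- bounds their norms.
  obtain ⟨s, hs⟩ := hcpt.elim_finite_subcover
    (fun k : K => (fun v : Fin q → K => k • v) ⁻¹' (M : Set (Fin q → K))ᶜ)
    (fun k => hcl.isOpen_compl.preimage (continuous_const_smul k))
    (fun v hv => by
      by_contra hcon
      have hv0 : v = 0 := hline v fun k => by
        by_contra hk
        exact hcon (Set.mem_iUnion.2 ⟨k, hk⟩)
      have h1 : 1 / ‖c‖ ≤ ‖v‖ := hv.2
      rw [hv0, norm_zero] at h1
      exact absurd (one_div_pos.2 hc0) (not_lt.2 h1))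
  obtain ⟨R, hR⟩ := (s.finite_toSet.image norm).bddAbove
  refine ⟨max R 0, fun v hv => ?_⟩
  by_contra! hlt
  have hv0 : v ≠ 0 := by
    rintro rfl
    rw [norm_zero] at hlt
    exact absurd (le_max_right R 0) (not_le.2 hlt)
  -- Rescale `v` into the shell by `d`. Some `k` sends `d • v` out of `M`, although `‖k * d‖ ≤ ‖v‖ *
  -- ‖d‖ ≤ 1` forces `(k * d) • v` to stay in `M`.
  obtain ⟨d, -, h1, h2, -⟩ := rescale_to_shell hc one_pos hv0
  obtain ⟨k, hk, hkv⟩ := Set.mem_iUnion₂.1 (hs ⟨by simpa using h1.le, h2⟩)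
  have hkR : ‖k‖ ≤ R := hR ⟨k, hk, rfl⟩
  refine hkv ?_
  change k • d • v ∈ M
  rw [smul_smul]
  refine hsmul _ ?_ v hv
  rw [norm_mul]
  rw [norm_smul] at h1
  calc ‖k‖ * ‖d‖ ≤ ‖v‖ * ‖d‖ := mul_le_mul_of_nonneg_right
        (hkR.trans ((le_max_left _ _).trans hlt.le)) (norm_nonneg _)
    _ ≤ 1 := by rw [mul_comm]; exact h1.le

/-- If a representation has no nonzero quotient with only eigenvalues of modulus one, then the only
invariant open subgroup is the whole space. -/
theorem HasNoModulusOneQuotient.eq_top_of_invariant [LocallyCompactSpace K] {A : Type*} [Group A]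
    {r : ℕ} {ρ : Representation K A (Fin r → K)} (hρ : HasNoModulusOneQuotient ρ)
    {H : AddSubgroup (Fin r → K)} (hH : ∀ a, ∀ x ∈ H, ρ a x ∈ H) {ε : ℝ} (hε : 0 < ε)
    (hball : ∀ x, ‖x‖ < ε → x ∈ H) : H = ⊤ := by
  have : ProperSpace K := ProperSpace.of_locallyCompactSpace K
  -- Unlike `H`, the subgroup generated by the orbit of a ball is known to be stable under scalars
  -- of modulus at most one.
  set M := AddSubgroup.closure {x | ∃ a y, ‖y‖ < ε ∧ ρ a y = x} with hM
  have hMH : M ≤ H := by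
    rw [hM, AddSubgroup.closure_le]
    rintro _ ⟨a, y, hy, rfl⟩
    exact hH a y (hball y hy)
  have hMa : ∀ a, ∀ x ∈ M, ρ a x ∈ M := by
    intro a
    have : M ≤ M.comap (ρ a).toAddMonoidHom := by
      nth_rw 1 [hM]
      rw [AddSubgroup.closure_le]
      rintro _ ⟨a', y, hy, rfl⟩
      refine AddSubgroup.subset_closure ⟨a * a', y, hy, ?_⟩
      rw [map_mul]
      rfl
    exact this
  have hMk : ∀ k : K, ‖k‖ ≤ 1 → ∀ x ∈ M, k • x ∈ M := by
    intro k hk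
    have : M ≤ M.comap (DistribSMul.toAddMonoidHom (Fin r → K) k) := by
      nth_rw 1 [hM]
      rw [AddSubgroup.closure_le]
      rintro _ ⟨a, y, hy, rfl⟩
      refine AddSubgroup.subset_closure ⟨a, k • y, ?_, ?_⟩
      · rw [norm_smul]
        exact (mul_le_of_le_one_left (norm_nonneg _) hk).trans_lt hy
      · simp
    exact this
  have hMball : ∀ x, ‖x‖ < ε → x ∈ M := fun x hx =>
    AddSubgroup.subset_closure ⟨1, x, hx, by simp⟩
  have hMopen : IsOpen (M : Set (Fin r → K)) :=
    M.isOpen_of_mem_nhds (g := 0) (Filter.mem_of_superset (Metric.ball_mem_nhds 0 hε)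
      fun x hx => hMball x (by simpa using hx))
  set W : Submodule K (Fin r → K) := M.linearPart with hW
  have hWM : ∀ x ∈ W, x ∈ M := fun x hx => by simpa using hx 1
  have hWa : ∀ a, W ≤ W.comap (ρ a) := fun a x hx k => by
    rw [← map_smul]
    exact hMa a _ (hx k)
  suffices hWtop : W = ⊤ by
    refine (AddSubgroup.eq_top_iff' _).2 fun x => hMH (hWM x ?_)
    rw [hWtop]
    trivial
  refine hρ W hWa fun a => ?_
  set b := Module.finBasis K ((Fin r → K) ⧸ W) with hb
  set p : (Fin r → K) →ₗ[K] (Fin (Module.finrank K ((Fin r → K) ⧸ W)) → K) :=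
    b.equivFun.toLinearMap ∘ₗ W.mkQ with hp
  have hpsurj : Function.Surjective p := b.equivFun.surjective.comp W.mkQ_surjective
  have hpker : ∀ x y, p x = p y → x - y ∈ W := by
    intro x y hxy
    have : W.mkQ x = W.mkQ y := b.equivFun.injective hxy
    exact (Submodule.Quotient.eq W).1 this
  -- Dividing by the largest linear subspace leaves an image without lines: a line in the image
  -- would lift into `W`. So the image of `M` is bounded.
  obtain ⟨R, hR⟩ := AddSubgroup.exists_norm_le_of_isOpen (K := K) (M := M.map p.toAddMonoidHom)
    (by
      have := p.isOpenMap_of_finiteDimensional hpsurj _ hMopen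
      simpa using this)
    (by
      rintro k hk _ ⟨x, hx, rfl⟩
      exact ⟨k • x, hMk k hk x hx, map_smul p k x⟩)
    (by
      intro y hy
      obtain ⟨x, rfl⟩ := hpsurj y
      have hx : x ∈ W := fun k => by
        obtain ⟨z, hz, hzx⟩ := hy k
        have h1 : k • x - z ∈ W := hpker _ _ (by rw [map_smul]; exact hzx.symm)
        have h2 := M.add_mem (hWM _ h1) hz
        rwa [sub_add_cancel] at h2
      have : W.mkQ x = 0 := (Submodule.Quotient.mk_eq_zero W).2 hx
      simp [hp, this])
  -- A bound uniform in `a`: multiples of lifts of the basis vectors lie in the ball, so their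
  -- orbits stay in `M`, whose image is bounded. It applies to all powers of `ρ a` and of its
  -- inverse.
  obtain ⟨C, hC⟩ : ∃ C, ∀ a i j, ‖LinearMap.toMatrix b b (W.mapQ W (ρ a) (hWa a)) i j‖ ≤ C := by
    have hx : ∀ j, ∃ x : Fin r → K, W.mkQ x = b j := fun j => W.mkQ_surjective _
    choose x hx using hx
    have hc : ∀ j, ∃ c : K, c ≠ 0 ∧ ‖c • x j‖ < ε := by
      intro j
      obtain ⟨c, hc0, hc⟩ := NormedField.exists_norm_lt K (r := ε / (‖x j‖ + 1)) (by positivity)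
      refine ⟨c, norm_pos_iff.1 hc0, ?_⟩
      rw [norm_smul]
      rw [lt_div_iff₀ (by positivity)] at hc
      nlinarith
    choose c hc0 hc using hc
    refine ⟨∑ j, R / ‖c j‖, fun a i j => ?_⟩
    have hRnn : 0 ≤ R := (norm_nonneg _).trans (hR 0 (AddSubgroup.zero_mem _))
    refine le_trans ?_ (Finset.single_le_sum (f := fun j => R / ‖c j‖)
      (fun j _ => by positivity) (Finset.mem_univ j))
    rw [le_div_iff₀ (norm_pos_iff.2 (hc0 j)), mul_comm, ← norm_mul]
    have h1 := hR (p (ρ a (c j • x j))) ⟨_, hMa a _ (hMball _ (hc j)), rfl⟩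
    have h2 : p (ρ a (c j • x j)) = c j • b.equivFun (W.mapQ W (ρ a) (hWa a) (b j)) := by
      rw [map_smul, map_smul, ← hx j]
      rfl
    have h3 := (norm_le_pi_norm (p (ρ a (c j • x j))) i).trans h1
    rw [h2] at h3
    simpa [LinearMap.toMatrix_apply] using h3
  have hpow : ∀ (a : A) (n : ℕ), W.mapQ W (ρ a) (hWa a) ^ n = W.mapQ W (ρ (a ^ n)) (hWa _) := by
    intro a n
    induction n with
    | zero =>
      refine LinearMap.ext fun x => ?_
      obtain ⟨v, rfl⟩ := W.mkQ_surjective x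
      simp
    | succ n ih =>
      refine LinearMap.ext fun x => ?_
      obtain ⟨v, rfl⟩ := W.mkQ_surjective x
      rw [pow_succ', ih]
      change W.mkQ (ρ a (ρ (a ^ n) v)) = W.mkQ (ρ (a ^ (n + 1)) v)
      rw [pow_succ', map_mul]
      rfl
  refine hasOnlyModulusOneEigenvalues_of_bounded b (T' := W.mapQ W (ρ a⁻¹) (hWa _)) ?_ (C := C)
    (fun n i j => by rw [hpow]; exact hC _ i j) (fun n i j => by rw [hpow]; exact hC _ i j)
  refine LinearMap.ext fun x => ?_
  obtain ⟨v, rfl⟩ := W.mkQ_surjective x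
  change W.mkQ ((ρ a⁻¹ * ρ a) v) = W.mkQ v
  rw [← map_mul, inv_mul_cancel, map_one]
  rfl

end ModulusOne

/-! ### Sums of edge functions along words, and areas. -/

section PathSum

variable {G : Type*} [Group G] {S : Set G}

/-- The permutation of `G × ℝ` that moves the first coordinate along the edge labelled by `s` and
adds the value of `F` on this edge to the second one. -/
def edgePerm (F : G → G → ℝ) (s : G) : Equiv.Perm (G × ℝ) where
  toFun p := (p.1 * s, p.2 + F p.1 (p.1 * s))
  invFun p := (p.1 * s⁻¹, p.2 - F (p.1 * s⁻¹) p.1)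
  left_inv p := by simp
  right_inv p := by simp

/-- The action of words on `G × ℝ` from the right, through `edgePerm`. -/
def pathPerm (F : G → G → ℝ) : FreeGroup S →* (Equiv.Perm (G × ℝ))ᵐᵒᵖ :=
  FreeGroup.lift fun s : S => MulOpposite.op (edgePerm F s)

/-- The sum of `F` over the oriented edges of the path that starts at `g` and is labelled by the
word `w`. -/
def pathSum (F : G → G → ℝ) (w : FreeGroup S) (g : G) : ℝ :=
  ((pathPerm F w).unop (g, 0)).2

/-- Summing through a permutation action makes the sum well defined on the free group, since
backtracking cancels. The starting value of the second coordinate is merely carried along, which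
yields the cocycle rule `pathSum_mul`. -/
theorem pathPerm_apply (F : G → G → ℝ) (w : FreeGroup S) (g : G) (r : ℝ) :
    (pathPerm F w).unop (g, r) = (g * freeProj S w, r + pathSum F w g) := by
  unfold pathSum
  induction w using FreeGroup.induction_on generalizing g r with
  | C1 => simp
  | of s => simp [pathPerm, freeProj, edgePerm]
  | inv_of s _ =>
    simp [pathPerm, freeProj, edgePerm, sub_eq_add_neg, Equiv.symm]
  | mul x y hx hy =>
    simp only [map_mul, MulOpposite.unop_mul, Equiv.Perm.mul_apply]
    rw [hx g r, hx g 0, hy, hy _ (0 + _)]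
    simp [mul_assoc, add_assoc]

theorem pathSum_mul (F : G → G → ℝ) (u v : FreeGroup S) (g : G) :
    pathSum F (u * v) g = pathSum F u g + pathSum F v (g * freeProj S u) := by
  conv_lhs => unfold pathSum
  rw [map_mul, MulOpposite.unop_mul, Equiv.Perm.mul_apply, pathPerm_apply, pathPerm_apply, zero_add]

@[simp]
theorem pathSum_one (F : G → G → ℝ) (g : G) : pathSum F (1 : FreeGroup S) g = 0 := by
  simp [pathSum]

theorem pathSum_inv (F : G → G → ℝ) (u : FreeGroup S) (g : G) :
    pathSum F u⁻¹ g = -pathSum F u (g * (freeProj S u)⁻¹) := by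
  have := pathSum_mul F u⁻¹ u g
  rw [inv_mul_cancel, pathSum_one, map_inv] at this
  linarith

theorem pathSum_of (F : G → G → ℝ) (s : S) (g : G) :
    pathSum F (FreeGroup.of s) g = F g (g * s) := by
  simp [pathSum, pathPerm, edgePerm]

/-- As `r` is a loop, the path returns along `u` and both traversals cancel. Conjugation only moves
the base point, so bounds uniform in the base point pass to conjugates. -/
theorem pathSum_conj (F : G → G → ℝ) (u r : FreeGroup S) (hr : freeProj S r = 1) (g : G) :
    pathSum F (u * r * u⁻¹) g = pathSum F r (g * freeProj S u) := by
  rw [pathSum_mul, pathSum_mul, pathSum_inv, map_mul, hr, mul_one, mul_inv_cancel_right]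
  ring

/-- A function on edges whose sums over all short relators are bounded by `δ` bounds areas from
below. -/
theorem abs_pathSum_list_prod_le (F : G → G → ℝ) {d : ℕ} {δ : ℝ}
    (hF : ∀ r ∈ relators S d, ∀ g, |pathSum F r g| ≤ δ) (l : List (FreeGroup S))
    (hl : ∀ x ∈ l, x ∈ Group.conjugatesOfSet (relators S d) ∨
      x⁻¹ ∈ Group.conjugatesOfSet (relators S d)) (g : G) :
    |pathSum F l.prod g| ≤ l.length * δ := by
  have hconj : ∀ x ∈ Group.conjugatesOfSet (relators S d),
      freeProj S x = 1 ∧ ∀ g, |pathSum F x g| ≤ δ := by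
    intro x hx
    obtain ⟨r, hr, hrx⟩ := Group.mem_conjugatesOfSet_iff.1 hx
    obtain ⟨u, rfl⟩ := isConj_iff.1 hrx
    have hr1 : freeProj S r = 1 := hr.1
    refine ⟨by simp [hr1], fun g => ?_⟩
    rw [pathSum_conj F u r hr1]
    exact hF r hr _
  have hstep : ∀ x ∈ l, freeProj S x = 1 ∧ ∀ g, |pathSum F x g| ≤ δ := by
    intro x hx
    rcases hl x hx with h | h
    · exact hconj x h
    · obtain ⟨h1, h2⟩ := hconj _ h
      rw [map_inv, inv_eq_one] at h1
      refine ⟨h1, fun g => ?_⟩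
      have := h2 g
      rwa [pathSum_inv, h1, inv_one, mul_one, abs_neg] at this
  clear hl
  induction l generalizing g with
  | nil => simp
  | cons x l ih =>
    obtain ⟨h1, h2⟩ := hstep x List.mem_cons_self
    have h3 := ih (g * freeProj S x) fun y hy => hstep y (List.mem_cons_of_mem _ hy)
    rw [List.prod_cons, pathSum_mul]
    calc _ ≤ _ := abs_add_le _ _
      _ ≤ δ + l.length * δ := add_le_add (h2 g) h3
      _ = _ := by rw [List.length_cons]; push_cast; ring

end PathSum

/-! ### Crossings of the level zero of a height function. -/

section Crossing

variable {G : Type*} [Group G] {S : Set G}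

/-- The indicator function of the set where the height `h` is nonnegative. -/
noncomputable def upperHalf (h : G → ℝ) (g : G) : ℝ :=
  open Classical in if 0 ≤ h g then 1 else 0

theorem abs_upperHalf_sub_le {X : Type*} (h : X → ℝ) (g g' : X) : |upperHalf h g - upperHalf h g'| ≤ 1 := by
  unfold upperHalf
  split_ifs <;> norm_num

/-- A step of height at most `ρ` can change sides only from a point of the strip `|h| ≤ ρ`, so
control of `x` is needed only there. -/
theorem abs_upperHalf_sub_mul_le {h : G → ℝ} (hh : ∀ x y, h (x * y) = h x + h y) {g u : G}
    {ρ x ε : ℝ} (hε : 0 ≤ ε) (hu : |h u| ≤ ρ) (hx : |h g| ≤ ρ → |x| ≤ ε) :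
    |(upperHalf h (g * u) - upperHalf h g) * x| ≤ ε := by
  by_cases hg : |h g| ≤ ρ
  · rw [abs_mul]
    calc _ ≤ 1 * ε := mul_le_mul (abs_upperHalf_sub_le _ _ _) (hx hg) (abs_nonneg _) zero_le_one
      _ = ε := one_mul ε
  · have : upperHalf h (g * u) = upperHalf h g := by
      unfold upperHalf
      rw [hh]
      rw [not_le, lt_abs] at hg
      rw [abs_le] at hu
      rcases hg with hg | hg
      · rw [if_pos (by linarith), if_pos (by linarith)]
      · rw [if_neg (by linarith), if_neg (by linarith)]
    rw [this, sub_self, zero_mul, abs_zero]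
    exact hε

/-- The function on edges whose sum over a path counts the values of `φ` at the points where the
path crosses the level `0` of `h`, with a sign. -/
noncomputable def crossing (h φ : G → ℝ) (x y : G) : ℝ :=
  (upperHalf h y - upperHalf h x) * φ x

/-- Up to an error `δ`, the crossings of all translates of the path `w` are as if the path crossed
the level `0` at its starting point, or not at all. -/
def CrossesAtStart (h φ : G → ℝ) (w : FreeGroup S) (δ : ℝ) : Prop :=
  ∀ g, |pathSum (crossing h φ) w g -
    (upperHalf h (g * freeProj S w) - upperHalf h g) * φ g| ≤ δ

variable {h φ : G → ℝ}

theorem abs_height_freeProj_le (hh : ∀ x y, h (x * y) = h x + h y) {c : ℝ}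
    (hc : ∀ s ∈ S, |h s| ≤ c) (L : List (S × Bool)) :
    |h (freeProj S (FreeGroup.mk L))| ≤ c * L.length := by
  have h1 : h 1 = 0 := by have := hh 1 1; rw [mul_one] at this; linarith
  have hinv : ∀ x, h x⁻¹ = -h x := fun x => by
    have := hh x⁻¹ x
    rw [inv_mul_cancel, h1] at this
    linarith
  induction L with
  | nil => simp [← FreeGroup.one_eq_mk, h1]
  | cons x L ih =>
    have hx : |h (freeProj S (FreeGroup.mk [x]))| ≤ c := by
      obtain ⟨s, b⟩ := x
      cases b <;> simp [freeProj, hinv, hc]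
    have : FreeGroup.mk (x :: L) = FreeGroup.mk [x] * FreeGroup.mk L := by simp [FreeGroup.mul_mk]
    rw [this, map_mul, hh]
    calc _ ≤ _ := abs_add_le _ _
      _ ≤ c + c * L.length := add_le_add hx ih
      _ = _ := by rw [List.length_cons]; push_cast; ring

/-- Each letter costs at most `2ε`: one `ε` for an inverse letter, where `crossing` evaluates `φ` at
the end of the step instead of its start, and one for moving the evaluation point of the rest of the
word back to `g`. Both errors arise only inside the strip where `φ` varies slowly, since otherwise
nothing is crossed. -/
theorem crossesAtStart_mk (hh : ∀ x y, h (x * y) = h x + h y) {c R ε : ℝ}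
    (hc0 : 0 ≤ c) (hε : 0 ≤ ε) (hc : ∀ s ∈ S, |h s| ≤ c)
    (hφ : ∀ g, |h g| ≤ R → ∀ s ∈ S, |φ (g * s) - φ g| ≤ ε ∧ |φ (g * s⁻¹) - φ g| ≤ ε)
    (L : List (S × Bool)) (hL : c * L.length ≤ R) :
    CrossesAtStart h φ (FreeGroup.mk L) (2 * ε * L.length) := by
  have h1 : h 1 = 0 := by have := hh 1 1; rw [mul_one] at this; linarith
  have hinv : ∀ x, h x⁻¹ = -h x := fun x => by
    have := hh x⁻¹ x
    rw [inv_mul_cancel, h1] at this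
    linarith
  induction L with
  | nil => intro g; simp [← FreeGroup.one_eq_mk]
  | cons x L ih =>
    have hL' : c * L.length + c ≤ R := by
      rw [List.length_cons] at hL; push_cast at hL; linarith
    have hcL : 0 ≤ c * L.length := by positivity
    specialize ih (by linarith)
    intro g
    have e : FreeGroup.mk (x :: L) = FreeGroup.mk [x] * FreeGroup.mk L := by simp [FreeGroup.mul_mk]
    obtain ⟨y, hy⟩ : ∃ y, freeProj S (FreeGroup.mk [x]) = y := ⟨_, rfl⟩
    have hyc : |h y| ≤ c := by
      have := abs_height_freeProj_le hh hc [x]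
      rw [hy] at this
      simpa using this
    have hback : |h (g * y)| ≤ R → |φ (g * y) - φ g| ≤ ε := by
      intro hg
      obtain ⟨s, b⟩ := x
      cases b
      · have hy' : y = (s : G)⁻¹ := by rw [← hy]; simp [freeProj]
        have := (hφ _ hg s s.2).1
        rw [abs_sub_comm]
        simpa [hy'] using this
      · have hy' : y = (s : G) := by rw [← hy]; simp [freeProj]
        have := (hφ _ hg s s.2).2
        rw [abs_sub_comm]
        simpa [hy'] using this
    have hstep : |pathSum (crossing h φ) (FreeGroup.mk [x]) g -
        (upperHalf h (g * y) - upperHalf h g) * φ g| ≤ ε := by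
      obtain ⟨s, b⟩ := x
      cases b
      · have hy' : y = (s : G)⁻¹ := by rw [← hy]; simp [freeProj]
        have e : (FreeGroup.mk [(s, false)] : FreeGroup S) = (FreeGroup.of s)⁻¹ := by
          simp [FreeGroup.of, FreeGroup.inv_mk, FreeGroup.invRev]
        have hs : freeProj S (FreeGroup.of s) = s := by simp [freeProj]
        rw [e, pathSum_inv, pathSum_of, hs, ← hy', crossing]
        have h2 : g * y * s = g := by rw [hy', inv_mul_cancel_right]
        rw [h2]
        have := abs_upperHalf_sub_mul_le hh (g := g) (u := y) (ρ := c) (x := φ (g * y) - φ g)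
          hε hyc (fun hg => by
            have := (hφ g (by linarith) s s.2).2
            rwa [← hy'] at this)
        convert this using 2
        ring
      · have hy' : y = (s : G) := by rw [← hy]; simp [freeProj]
        have e : (FreeGroup.mk [(s, true)] : FreeGroup S) = FreeGroup.of s := rfl
        rw [e, pathSum_of, hy', crossing, sub_self, abs_zero]
        exact hε
    have hrest := ih (g * y)
    have hcross := abs_upperHalf_sub_mul_le hh (g := g * y) (u := freeProj S (FreeGroup.mk L))
      (ρ := c * L.length) (x := φ (g * y) - φ g) hε (abs_height_freeProj_le hh hc L)
      (fun hg => hback (by linarith))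
    rw [e, pathSum_mul, map_mul, hy, ← mul_assoc]
    rw [abs_le] at *
    rw [List.length_cons]
    push_cast
    constructor <;> nlinarith [hstep.1, hstep.2, hrest.1, hrest.2, hcross.1, hcross.2]

open Classical in
theorem crossesAtStart_of_freeLength_le (hh : ∀ x y, h (x * y) = h x + h y) {c ε : ℝ} {m : ℕ}
    (hc0 : 0 ≤ c) (hε : 0 ≤ ε) (hc : ∀ s ∈ S, |h s| ≤ c)
    (hφ : ∀ g, |h g| ≤ c * m → ∀ s ∈ S, |φ (g * s) - φ g| ≤ ε ∧ |φ (g * s⁻¹) - φ g| ≤ ε)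
    (w : FreeGroup S) (hw : freeLength w ≤ m) : CrossesAtStart h φ w (2 * ε * m) := by
  have hle : (w.toWord.length : ℝ) ≤ m := by exact_mod_cast hw
  have := crossesAtStart_mk hh hc0 hε hc hφ w.toWord (mul_le_mul_of_nonneg_left hle hc0)
  rw [FreeGroup.mk_toWord] at this
  intro g
  exact (this g).trans (mul_le_mul_of_nonneg_left hle (by linarith))

/-- Since `φ` is invariant under `T`, errors merely add up, and slow variation of `φ` is not needed
on a strip whose width grows with `n`. -/
theorem CrossesAtStart.pow {T : FreeGroup S} {δ : ℝ} (hT : CrossesAtStart h φ T δ)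
    (hφ : ∀ g, φ (g * freeProj S T) = φ g) (n : ℕ) : CrossesAtStart h φ (T ^ n) (n * δ) := by
  induction n with
  | zero => intro g; simp
  | succ n ih =>
    intro g
    have h1 := hT g
    have h2 := ih (g * freeProj S T)
    rw [hφ] at h2
    rw [pow_succ', pathSum_mul, map_mul, ← mul_assoc]
    rw [abs_le] at *
    push_cast
    constructor <;> linarith [h1.1, h1.2, h2.1, h2.2]

theorem CrossesAtStart.inv {T : FreeGroup S} {δ : ℝ} (hT : CrossesAtStart h φ T δ)
    (hφ : ∀ g, φ (g * freeProj S T) = φ g) : CrossesAtStart h φ T⁻¹ δ := by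
  intro g
  have h1 := hT (g * (freeProj S T)⁻¹)
  have h2 := hφ (g * (freeProj S T)⁻¹)
  rw [inv_mul_cancel_right] at h1 h2
  rw [pathSum_inv, map_inv]
  rw [← h2] at h1
  rw [abs_le] at *
  constructor <;> linarith [h1.1, h1.2]

/-- The starting point and the ends of the three pieces all have nonnegative height, and height `0`
counts as upper; only the errors `n`, `1` and `n` times `δ` remain. -/
theorem CrossesAtStart.abs_pathSum_up_le (hh : ∀ x y, h (x * y) = h x + h y) {T A : FreeGroup S}
    {δ : ℝ} (hT : CrossesAtStart h φ T δ) (hA : CrossesAtStart h φ A δ)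
    (hφ : ∀ g, φ (g * freeProj S T) = φ g) (hτ : 0 < h (freeProj S T))
    (hα : h (freeProj S A) = 0) (n : ℕ) (g : G) (hg : h g = 0) :
    |pathSum (crossing h φ) (T ^ n * A * (T ^ n)⁻¹) g| ≤ (2 * n + 1) * δ := by
  have hpow : ∀ n : ℕ, h (freeProj S T ^ n) = n * h (freeProj S T) := by
    intro n
    induction n with
    | zero => have := hh 1 1; rw [mul_one] at this; simp; linarith
    | succ n ih => rw [pow_succ, hh, ih]; push_cast; ring
  have hφn : ∀ (n : ℕ) g, φ (g * freeProj S (T ^ n)) = φ g := by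
    intro n
    induction n with
    | zero => simp
    | succ n ih => intro g; rw [pow_succ, map_mul, ← mul_assoc, hφ, ih]
  have hn : 0 ≤ (n : ℝ) * h (freeProj S T) := by positivity
  have h1 := hT.pow hφ n g
  have h2 := hA (g * freeProj S (T ^ n))
  have h3 := (hT.pow hφ n).inv (hφn n) (g * freeProj S (T ^ n) * freeProj S A)
  rw [map_inv] at h3
  have u0 : upperHalf h g = 1 := if_pos hg.ge
  have u1 : upperHalf h (g * freeProj S (T ^ n)) = 1 :=
    if_pos (by rw [hh, map_pow, hpow, hg, zero_add]; exact hn)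
  have u2 : upperHalf h (g * freeProj S (T ^ n) * freeProj S A) = 1 :=
    if_pos (by rw [hh, hh, map_pow, hpow, hg, hα, zero_add, add_zero]; exact hn)
  have u3 : upperHalf h (g * freeProj S (T ^ n) * freeProj S A * (freeProj S (T ^ n))⁻¹) = 1 := by
    refine if_pos ?_
    have := hh (g * freeProj S (T ^ n) * freeProj S A * (freeProj S (T ^ n))⁻¹) (freeProj S (T ^ n))
    rw [inv_mul_cancel_right, hh, hh, hg, hα] at this
    linarith
  rw [u0, u1] at h1
  rw [u1, u2] at h2
  rw [u2, u3] at h3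
  rw [pathSum_mul, pathSum_mul, map_mul, ← mul_assoc]
  rw [abs_le] at *
  constructor <;> linarith [h1.1, h1.2, h2.1, h2.2, h3.1, h3.2]

/-- The path leaves the upper half at `g` and returns at its endpoint. By invariance under `T`, `φ`
takes the same value at the end of the bottom piece as at the endpoint. For `n = 0` the path need
not descend. -/
theorem CrossesAtStart.abs_pathSum_down_sub_le (hh : ∀ x y, h (x * y) = h x + h y)
    {T A : FreeGroup S} {δ : ℝ} (hT : CrossesAtStart h φ T δ)
    (hA : CrossesAtStart h φ A δ) (hφ : ∀ g, φ (g * freeProj S T) = φ g)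
    (hτ : 0 < h (freeProj S T)) (hα : h (freeProj S A) = 0) {n : ℕ} (hn : n ≠ 0) (g : G)
    (hg : h g = 0) :
    |pathSum (crossing h φ) ((T ^ n)⁻¹ * A * T ^ n) g -
      (φ (g * freeProj S ((T ^ n)⁻¹ * A * T ^ n)) - φ g)| ≤ (2 * n + 1) * δ := by
  have hpow : ∀ n : ℕ, h (freeProj S T ^ n) = n * h (freeProj S T) := by
    intro n
    induction n with
    | zero => have := hh 1 1; rw [mul_one] at this; simp; linarith
    | succ n ih => rw [pow_succ, hh, ih]; push_cast; ring
  have hφn : ∀ (n : ℕ) g, φ (g * freeProj S (T ^ n)) = φ g := by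
    intro n
    induction n with
    | zero => simp
    | succ n ih => intro g; rw [pow_succ, map_mul, ← mul_assoc, hφ, ih]
  have hn0 : 0 < (n : ℝ) * h (freeProj S T) := by positivity
  have h1 := (hT.pow hφ n).inv (hφn n) g
  have h2 := hA (g * (freeProj S (T ^ n))⁻¹)
  have h3 := hT.pow hφ n (g * (freeProj S (T ^ n))⁻¹ * freeProj S A)
  have h4 := hφn n (g * (freeProj S (T ^ n))⁻¹ * freeProj S A)
  rw [map_inv] at h1
  have e1 : h (g * (freeProj S (T ^ n))⁻¹) = -(n * h (freeProj S T)) := by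
    have := hh (g * (freeProj S (T ^ n))⁻¹) (freeProj S (T ^ n))
    rw [inv_mul_cancel_right, map_pow, hpow, hg] at this
    rw [map_pow]
    linarith
  have u0 : upperHalf h g = 1 := if_pos hg.ge
  have u1 : upperHalf h (g * (freeProj S (T ^ n))⁻¹) = 0 :=
    if_neg (by rw [e1]; linarith)
  have u2 : upperHalf h (g * (freeProj S (T ^ n))⁻¹ * freeProj S A) = 0 :=
    if_neg (by rw [hh, e1, hα]; linarith)
  have u3 : upperHalf h (g * (freeProj S (T ^ n))⁻¹ * freeProj S A * freeProj S (T ^ n)) = 1 :=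
    if_pos (by rw [hh, hh, e1, hα, map_pow, hpow]; linarith)
  rw [u0, u1] at h1
  rw [u1, u2] at h2
  rw [u2, u3] at h3
  rw [pathSum_mul, pathSum_mul]
  simp only [map_mul, map_inv, ← mul_assoc]
  rw [h4]
  rw [abs_le] at *
  constructor <;> linarith [h1.1, h1.2, h2.1, h2.2, h3.1, h3.2]

end Crossing

/-! ### Iterated commutators and iterated differences. -/

section IteratedCommutator

/-- The `k`-th iterated difference of `f` with step `x`, starting with the difference of
step `y`. -/
def iteratedDifference {V : Type*} [AddCommGroup V] (f : V → ℝ) (x y : V) : ℕ → V → ℝ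
  | 0, p => f (p + y) - f p
  | k + 1, p => iteratedDifference f x y k (p + x) - iteratedDifference f x y k p

/-- The differences vanish at the positive multiples of `x` within range, so each further difference
only changes the sign of the value at `0`. -/
theorem abs_iteratedDifference_zero {V : Type*} [AddCommGroup V] {f : V → ℝ} {x y : V} {k : ℕ}
    (h0 : f 0 = 1) (hx : ∀ i ≤ k, i ≠ 0 → f (i • x) = 0) (hy : ∀ i ≤ k, f (i • x + y) = 0) :
    |iteratedDifference f x y k 0| = 1 := by
  have key : ∀ j ≤ k, (∀ i, i ≠ 0 → i + j ≤ k → iteratedDifference f x y j (i • x) = 0) ∧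
      |iteratedDifference f x y j 0| = 1 := by
    intro j
    induction j with
    | zero =>
      intro _
      refine ⟨fun i hi hik => ?_, ?_⟩
      · simp only [iteratedDifference]
        rw [hy i (by omega), hx i (by omega) hi, sub_zero]
      · simp only [iteratedDifference]
        have := hy 0 (by omega)
        rw [zero_smul] at this
        rw [this, h0]
        norm_num
    | succ j ih =>
      intro hj
      obtain ⟨h1, h2⟩ := ih (by omega)
      refine ⟨fun i hi hik => ?_, ?_⟩
      · simp only [iteratedDifference]
        rw [← succ_nsmul, h1 _ (by omega) (by omega), h1 i hi (by omega), sub_zero]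
      · simp only [iteratedDifference]
        have := h1 1 one_ne_zero (by omega)
        rw [one_smul] at this
        rw [zero_add, this, zero_sub, abs_neg, h2]
  exact (key k le_rfl).2

variable {G : Type*} [Group G] {S : Set G}

open Classical in
theorem freeLength_iterate_commutator_le {X : Type*} {S : Set X} {A B : FreeGroup S} {N : ℕ} (hA : freeLength A ≤ N)
    (hB : freeLength B ≤ N) (k : ℕ) :
    freeLength ((fun z => ⁅A, z⁆)^[k] B) ≤ 4 ^ k * N := by
  unfold freeLength at *
  induction k with
  | zero => simpa using hB
  | succ k ih =>
    rw [Function.iterate_succ_apply', commutatorElement_def]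
    set W := (fun z => ⁅A, z⁆)^[k] B
    have h1 := FreeGroup.norm_mul_le (A * W * A⁻¹) W⁻¹
    have h2 := FreeGroup.norm_mul_le (A * W) A⁻¹
    have h3 := FreeGroup.norm_mul_le A W
    rw [FreeGroup.norm_inv_eq] at h1 h2
    have h4 : N ≤ 4 ^ k * N := Nat.le_mul_of_pos_left N (by positivity)
    rw [pow_succ]
    linarith

theorem freeProj_iterate_commutator (A B : FreeGroup S) (k : ℕ) :
    freeProj S ((fun z => ⁅A, z⁆)^[k] B) =
      (fun z => ⁅freeProj S A, z⁆)^[k] (freeProj S B) := by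
  induction k with
  | zero => rfl
  | succ k ih =>
    rw [Function.iterate_succ_apply', Function.iterate_succ_apply', map_commutatorElement, ih]

/-- In `⁅A, W⁆` the two passages of `A` are negligible, while `W` is run forwards from a point
shifted by the position of `A` and backwards to a point at the original position: a difference with
that step. The error obeys `2δ + 2 * 4 ^ k * δ ≤ 4 ^ (k + 1) * δ`. -/
theorem abs_pathSum_iterate_commutator_sub_le {V : Type*} [AddCommGroup V] {F : G → G → ℝ}
    {N : Subgroup G} {pos : G → V} (hpos : ∀ g ∈ N, ∀ g', pos (g * g') = pos g + pos g')
    {f : V → ℝ} {A B : FreeGroup S} {δ : ℝ} (hδ : 0 ≤ δ) (hA : freeProj S A ∈ N)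
    (hB : freeProj S B ∈ N) (hFA : ∀ g ∈ N, |pathSum F A g| ≤ δ)
    (hFB : ∀ g ∈ N, |pathSum F B g - (f (pos g + pos (freeProj S B)) - f (pos g))| ≤ δ)
    (k : ℕ) (g : G) (hg : g ∈ N) :
    |pathSum F ((fun z => ⁅A, z⁆)^[k] B) g -
      iteratedDifference f (pos (freeProj S A)) (pos (freeProj S B)) k (pos g)| ≤ 4 ^ k * δ := by
  induction k generalizing g with
  | zero => simpa [iteratedDifference] using hFB g hg
  | succ k ih =>
    have hWN : freeProj S ((fun z => ⁅A, z⁆)^[k] B) ∈ N := by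
      clear ih
      induction k with
      | zero => exact hB
      | succ k ih =>
        rw [Function.iterate_succ_apply', map_commutatorElement]
        exact N.mul_mem (N.mul_mem (N.mul_mem hA ih) (N.inv_mem hA)) (N.inv_mem ih)
    rw [Function.iterate_succ_apply']
    set W := (fun z => ⁅A, z⁆)^[k] B
    obtain ⟨a, ha⟩ : ∃ a, freeProj S A = a := ⟨_, rfl⟩
    obtain ⟨b, hb⟩ : ∃ b, freeProj S W = b := ⟨_, rfl⟩
    rw [ha] at hA ih ⊢
    rw [hb] at hWN
    have hga := N.mul_mem hg hA
    have hlast := N.mul_mem (N.mul_mem (N.mul_mem hga hWN) (N.inv_mem hA)) (N.inv_mem hWN)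
    have hpos1 : pos 1 = 0 := by
      have := hpos 1 N.one_mem 1
      rwa [mul_one, left_eq_add] at this
    have hinv : ∀ x ∈ N, pos x⁻¹ = -pos x := by
      intro x hx
      have := hpos x hx x⁻¹
      rw [mul_inv_cancel, hpos1] at this
      exact (neg_eq_of_add_eq_zero_right this.symm).symm
    have e1 : pos (g * a) = pos g + pos a := hpos g hg a
    have e2 : pos (g * a * b * a⁻¹ * b⁻¹) = pos g := by
      rw [hpos _ (N.mul_mem (N.mul_mem hga hWN) (N.inv_mem hA)), hpos _ (N.mul_mem hga hWN),
        hpos _ hga, e1, hinv a hA, hinv b hWN]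
      abel
    have h1 := hFA g hg
    have h2 := ih (g * a) hga
    have h3 := hFA (g * a * b * a⁻¹) (N.mul_mem (N.mul_mem hga hWN) (N.inv_mem hA))
    have h4 := ih _ hlast
    rw [e1] at h2
    rw [e2] at h4
    have e : pathSum F ⁅A, W⁆ g = pathSum F A g + pathSum F W (g * a) -
        pathSum F A (g * a * b * a⁻¹) - pathSum F W (g * a * b * a⁻¹ * b⁻¹) := by
      rw [commutatorElement_def, pathSum_mul, pathSum_mul, pathSum_mul, pathSum_inv, pathSum_inv]
      simp only [map_mul, map_inv, ha, hb, mul_assoc]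
      ring
    rw [e]
    simp only [iteratedDifference]
    have h5 : (1 : ℝ) ≤ 4 ^ k := one_le_pow₀ (by norm_num)
    have h6 : δ ≤ 4 ^ k * δ := le_mul_of_one_le_left hδ h5
    rw [pow_succ]
    rw [abs_le] at *
    constructor <;> linarith [h1.1, h1.2, h2.1, h2.2, h3.1, h3.2, h4.1, h4.2]

end IteratedCommutator

/-! ### The lower bound on areas for a general test function. -/

section LowerBound

variable {G : Type*} [Group G] {S : Set G}

open Classical in
/-- The main estimate: a null-homotopic word of length linear in `n`, and a lower bound on its area
in terms of the variation `ε` of a test function `f`. -/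
theorem exists_relator_of_testFunction {V : Type*} [AddCommGroup V] {h : G → ℝ} {pos : G → V}
    {N : Subgroup G} [hN : N.Normal] (hh : ∀ x y, h (x * y) = h x + h y) (hhN : ∀ g ∈ N, h g = 0)
    (hpos : ∀ g ∈ N, ∀ g', pos (g * g') = pos g + pos g') {T A : FreeGroup S}
    (hτ : 0 < h (freeProj S T)) (hposτ : ∀ g, pos (g * freeProj S T) = pos g)
    (hα : freeProj S A ∈ N) {k : ℕ} (hk : ∀ x ∈ N, ∀ y ∈ N, (fun z => ⁅x, z⁆)^[k] y = 1)
    {c : ℝ} {m d : ℕ} (hc0 : 0 ≤ c) (hc : ∀ s ∈ S, |h s| ≤ c) (hTm : freeLength T ≤ m)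
    (hAm : freeLength A ≤ m) (hdm : d ≤ m) {n : ℕ} (hn : n ≠ 0) {f : V → ℝ} {ε : ℝ} (hε : 0 ≤ ε)
    (hf : ∀ g, |h g| ≤ c * m → ∀ s ∈ S,
      |f (pos (g * s)) - f (pos g)| ≤ ε ∧ |f (pos (g * s⁻¹)) - f (pos g)| ≤ ε)
    {x y : V} (hx : pos (freeProj S T ^ n * freeProj S A * (freeProj S T ^ n)⁻¹) = x)
    (hy : pos ((freeProj S T ^ n)⁻¹ * freeProj S A * freeProj S T ^ n) = y)
    (hf0 : f 0 = 1) (hfx : ∀ i ≤ k, i ≠ 0 → f (i • x) = 0) (hfy : ∀ i ≤ k, f (i • x + y) = 0) :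
    ∃ w ∈ (freeProj S).ker, freeLength w ≤ 4 ^ k * ((2 * n + 1) * m) ∧
      ∀ l : List (FreeGroup S), (∀ z ∈ l, z ∈ Group.conjugatesOfSet (relators S d) ∨
        z⁻¹ ∈ Group.conjugatesOfSet (relators S d)) → l.prod = w →
        1 ≤ (l.length + 4 ^ k * (2 * n + 1)) * (2 * ε * m) := by
  have hδ : 0 ≤ 2 * ε * m := by positivity
  have hcross := crossesAtStart_of_freeLength_le (φ := fun g => f (pos g)) hh hc0 hε hc hf
  have hφ : ∀ g, f (pos (g * freeProj S T)) = f (pos g) := fun g => by rw [hposτ]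
  have hα0 := hhN _ hα
  have hpow : ∀ n : ℕ, freeLength (T ^ n) ≤ n * m := by
    intro n
    induction n with
    | zero => simp [freeLength]
    | succ n ih =>
      rw [pow_succ, add_mul, one_mul]
      exact (FreeGroup.norm_mul_le _ _).trans (add_le_add ih hTm)
  have hpow' : freeLength (T ^ n)⁻¹ ≤ n * m := by
    have := hpow n
    unfold freeLength at *
    rwa [FreeGroup.norm_inv_eq]
  have hlen : ∀ u v : FreeGroup S, freeLength u ≤ n * m → freeLength v ≤ n * m →
      freeLength (u * A * v) ≤ (2 * n + 1) * m := by
    intro u v hu hv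
    have h1 := FreeGroup.norm_mul_le (u * A) v
    have h2 := FreeGroup.norm_mul_le u A
    unfold freeLength at *
    linarith
  have hUN : freeProj S (T ^ n * A * (T ^ n)⁻¹) ∈ N := by
    rw [map_mul, map_mul, map_inv]
    exact hN.conj_mem _ hα _
  have hLN : freeProj S ((T ^ n)⁻¹ * A * T ^ n) ∈ N := by
    rw [map_mul, map_mul, map_inv]
    exact hN.conj_mem' _ hα _
  refine ⟨(fun z => ⁅T ^ n * A * (T ^ n)⁻¹, z⁆)^[k] ((T ^ n)⁻¹ * A * T ^ n), ?_, ?_, ?_⟩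
  · rw [MonoidHom.mem_ker, freeProj_iterate_commutator]
    exact hk _ hUN _ hLN
  · exact freeLength_iterate_commutator_le (hlen _ _ (hpow n) hpow') (hlen _ _ hpow' (hpow n)) k
  · intro l hl hlw
    -- A short relator is a loop, so the main term of `CrossesAtStart` vanishes and its sum is at
    -- most `2 * ε * m` from every base point.
    have h1 := abs_pathSum_list_prod_le (crossing h fun g => f (pos g)) (d := d) (δ := 2 * ε * m)
      (fun r hr g => by
        have := hcross r (hr.2.trans hdm) g
        rwa [show freeProj S r = 1 from hr.1, mul_one, sub_self, zero_mul, sub_zero] at this)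
      l hl 1
    have h2 := abs_pathSum_iterate_commutator_sub_le (F := crossing h fun g => f (pos g)) hpos
      (f := f) (A := T ^ n * A * (T ^ n)⁻¹) (B := (T ^ n)⁻¹ * A * T ^ n)
      (δ := (2 * n + 1) * (2 * ε * m)) (by positivity) hUN hLN
      (fun g hg => (hcross T hTm).abs_pathSum_up_le hh (hcross A hAm) hφ hτ hα0 n g (hhN g hg))
      (fun g hg => by
        have := (hcross T hTm).abs_pathSum_down_sub_le hh (hcross A hAm) hφ hτ hα0 hn g
          (hhN g hg)
        rwa [hpos g hg] at this)
      k 1 N.one_mem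
    have hpos1 : pos 1 = 0 := by
      have := hpos 1 N.one_mem 1
      rwa [mul_one, left_eq_add] at this
    have h3 := abs_iteratedDifference_zero hf0 hfx hfy
    rw [hpos1] at h2
    simp only [map_mul, map_inv, map_pow, hx, hy] at h2
    rw [hlw] at h1
    have h4 : (1 : ℝ) ≤ 4 ^ k * ((2 * n + 1) * (2 * ε * m)) + l.length * (2 * ε * m) := by
      have := abs_sub_abs_le_abs_sub (iteratedDifference f x y k 0) (pathSum
        (crossing h fun g => f (pos g))
        ((fun z => ⁅T ^ n * A * (T ^ n)⁻¹, z⁆)^[k] ((T ^ n)⁻¹ * A * T ^ n)) 1)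
      rw [abs_sub_comm _ (pathSum _ _ _), h3] at this
      linarith
    linarith

end LowerBound

/-! ### Affine coordinates from a group of SOL type. -/

section Coordinates

/-- The data on a group `G` provided by a homomorphism with dense image to a group of SOL type: two
affine actions with linear parts `a`, `b` and translation parts `X`, `Y`, whose origins are chosen
to be fixed by an element `τ`. -/
structure SOLCoordinates (G K₁ K₂ : Type*) [Group G] [NontriviallyNormedField K₁]
    [NontriviallyNormedField K₂] where
  /-- The linear part of the first action. -/
  a : G →* K₁ˣ
  /-- The linear part of the second action. -/
  b : G →* K₂ˣ
  /-- The translation part of the first action. -/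
  X : G → K₁
  /-- The translation part of the second action. -/
  Y : G → K₂
  X_mul : ∀ g h, X (g * h) = X g + a g * X h
  Y_mul : ∀ g h, Y (g * h) = Y g + b g * Y h
  /-- An element that expands the first factor and contracts the second one. -/
  τ : G
  X_τ : X τ = 0
  Y_τ : Y τ = 0
  one_lt_norm_a_τ : 1 < ‖(a τ : K₁)‖
  norm_b_τ_lt_one : ‖(b τ : K₂)‖ < 1
  exists_ne_zero : ∃ g, X g ≠ 0 ∧ Y g ≠ 0
  abs_log_norm_b_le : ∃ c₁ c₂ : ℝ, 0 ≤ c₁ ∧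
    ∀ g, |Real.log ‖(b g : K₂)‖| ≤ c₁ * |Real.log ‖(a g : K₁)‖| + c₂

namespace SOLCoordinates

variable {G K₁ K₂ : Type*} [Group G] [NontriviallyNormedField K₁] [NontriviallyNormedField K₂]
  (P : SOLCoordinates G K₁ K₂)

/-- The coordinates are bounded on `S`. -/
def IsBoundedOn (S : Set G) : Prop :=
  ∃ c C : ℝ, ∀ s ∈ S, |Real.log ‖(P.a s : K₁)‖| ≤ c ∧ ‖P.X s‖ ≤ C ∧ ‖P.X s⁻¹‖ ≤ C ∧
    ‖P.Y s‖ ≤ C ∧ ‖P.Y s⁻¹‖ ≤ C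

theorem norm_natCast_le (K : Type*) [NontriviallyNormedField K] (i : ℕ) : ‖(i : K)‖ ≤ i := by
  simpa using Nat.norm_cast_le (α := K) i

/-- The conjugates of a translation by the powers of an element fixing the origin. -/
theorem affine_conj_pow {K : Type*} [Field K] {a : G →* Kˣ} {X : G → K}
    (hX : ∀ g h, X (g * h) = X g + a g * X h) {τ : G} (hτ : X τ = 0) (α : G) (n : ℕ) :
    X (τ ^ n * α * (τ ^ n)⁻¹) = a τ ^ n * X α ∧
      X ((τ ^ n)⁻¹ * α * τ ^ n) = ((a τ : K) ^ n)⁻¹ * X α := by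
  have h1 : X 1 = 0 := by simpa using hX 1 1
  have hn : ∀ n : ℕ, X (τ ^ n) = 0 := by
    intro n
    induction n with
    | zero => simpa using h1
    | succ n ih => rw [pow_succ, hX, ih, hτ, mul_zero, add_zero]
  have hn' : X (τ ^ n)⁻¹ = 0 := by
    have := hX (τ ^ n) (τ ^ n)⁻¹
    rw [mul_inv_cancel, h1, hn, zero_add, zero_eq_mul] at this
    exact this.resolve_left (Units.ne_zero _)
  constructor
  · rw [hX, hX, hn, hn', mul_zero, add_zero, zero_add, map_pow, Units.val_pow_eq_pow_val]
  · rw [hX, hX, hn, hn', mul_zero, add_zero, zero_add, map_inv, map_pow,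
      Units.val_inv_eq_inv_val, Units.val_pow_eq_pow_val]

/-- As `a τ ≠ 1` in the application, this moves an element with nonzero coordinates into the
commutator subgroup while keeping them nonzero. -/
theorem affine_commutator {K : Type*} [Field K] {a : G →* Kˣ} {X : G → K}
    (hX : ∀ g h, X (g * h) = X g + a g * X h) {τ : G} (hτ : X τ = 0) (g : G) :
    X ⁅τ, g⁆ = (a τ - 1) * X g := by
  have h1 : X 1 = 0 := by simpa using hX 1 1
  have h2 : X τ⁻¹ = 0 := by
    have := hX τ τ⁻¹
    rw [mul_inv_cancel, h1, hτ, zero_add, zero_eq_mul] at this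
    exact this.resolve_left (Units.ne_zero _)
  have h3 := hX g⁻¹ g
  rw [inv_mul_cancel, h1, map_inv, Units.val_inv_eq_inv_val] at h3
  have h4 : a (τ * g * τ⁻¹) = a g := by simp
  have h5 : X g⁻¹ = -((a g : K)⁻¹ * X g) := by linear_combination -h3
  rw [commutatorElement_def, hX, hX, hX, h4, h5, hτ, h2]
  have := (a g).ne_zero
  field_simp
  ring

-- The bound is applied to `ψ₁ (X) * ψ₂ (Y)`: the factor `ψ₁` kills the nonzero multiples of the
-- position of the upper conjugate, and `ψ₂` kills all translates by the lower one. The constants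
-- depend on neither `n` nor the profiles, so the profiles can be adapted to the fields and to `n`.
variable {P} in
theorem IsBoundedOn.exists_relator {S : Set G} (hS : P.IsBoundedOn S) (hgen : Subgroup.closure S = ⊤)
    [CharZero K₁] [Group.IsNilpotent (commutator G)] (d : ℕ) :
    ∃ (M n₀ : ℕ) (D κ ν : ℝ), 0 < D ∧ 0 < κ ∧ 1 < ν ∧ ∀ n ≥ n₀, ∀ (ψ₁ : K₁ → ℝ) (ψ₂ : K₂ → ℝ)
      (ε ρ : ℝ), 0 ≤ ε → ρ ≤ κ * ν ^ n → ψ₁ 0 = 1 → ψ₂ 0 = 1 → (∀ x, |ψ₁ x| ≤ 1) →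
      (∀ x, |ψ₂ x| ≤ 1) → (∀ x, ρ ≤ ‖x‖ → ψ₁ x = 0) → (∀ x, ρ ≤ ‖x‖ → ψ₂ x = 0) →
      (∀ x y, ‖x - y‖ ≤ D → |ψ₁ x - ψ₁ y| ≤ ε) → (∀ x y, ‖x - y‖ ≤ D → |ψ₂ x - ψ₂ y| ≤ ε) →
      ∃ w ∈ (freeProj S).ker, freeLength w ≤ M * (2 * n + 1) ∧
        ∀ l : List (FreeGroup S), (∀ z ∈ l, z ∈ Group.conjugatesOfSet (relators S d) ∨
          z⁻¹ ∈ Group.conjugatesOfSet (relators S d)) → l.prod = w →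
          1 ≤ (l.length + M * (2 * n + 1)) * (M * ε) := by
  obtain ⟨c, C, hcC⟩ := hS
  obtain ⟨c₁, c₂, hc₁, hc₂⟩ := P.abs_log_norm_b_le
  obtain ⟨g₀, hXg, hYg⟩ := P.exists_ne_zero
  obtain ⟨k, hk⟩ := (commutator G).exists_iterate_commutator_eq_one
  have hsurj : Function.Surjective (freeProj S) := by
    rw [← MonoidHom.range_eq_top]
    unfold freeProj
    rw [FreeGroup.range_lift_eq_closure, Subtype.range_coe, hgen]
  obtain ⟨T, hT⟩ := hsurj P.τ
  obtain ⟨A, hA⟩ := hsurj ⁅P.τ, g₀⁆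
  have hαN : ⁅P.τ, g₀⁆ ∈ commutator G :=
    Subgroup.commutator_mem_commutator (Subgroup.mem_top _) (Subgroup.mem_top _)
  have hkera : ∀ g ∈ commutator G, P.a g = 1 :=
    fun g hg => Abelianization.commutator_subset_ker P.a hg
  have hkerb : ∀ g ∈ commutator G, P.b g = 1 :=
    fun g hg => Abelianization.commutator_subset_ker P.b hg
  have ha1 : ∀ g, ‖(P.a g : K₁)‖ ≠ 0 := fun g => norm_ne_zero_iff.2 (Units.ne_zero _)
  have hb1 : ∀ g, ‖(P.b g : K₂)‖ ≠ 0 := fun g => norm_ne_zero_iff.2 (Units.ne_zero _)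
  set α := ⁅P.τ, g₀⁆ with hα
  have hXα : P.X α ≠ 0 := by
    rw [hα, affine_commutator P.X_mul P.X_τ]
    refine mul_ne_zero (fun h => ?_) hXg
    have := P.one_lt_norm_a_τ
    rw [sub_eq_zero.1 h, norm_one] at this
    exact this.false
  have hYα : P.Y α ≠ 0 := by
    rw [hα, affine_commutator P.Y_mul P.Y_τ]
    refine mul_ne_zero (fun h => ?_) hYg
    have := P.norm_b_τ_lt_one
    rw [sub_eq_zero.1 h, norm_one] at this
    exact this.false
  -- Integers may be small in a non-Archimedean field; characteristic zero keeps the finitely many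
  -- needed away from `0`.
  obtain ⟨θ, hθ0, hθ⟩ : ∃ θ : ℝ, 0 < θ ∧ ∀ i ≤ k, i ≠ 0 → θ ≤ ‖(i : K₁)‖ := by
    clear hk
    induction k with
    | zero => exact ⟨1, one_pos, fun i hi hi' => absurd (Nat.le_zero.1 hi) hi'⟩
    | succ k ih =>
      obtain ⟨θ, hθ0, hθ⟩ := ih
      refine ⟨min θ ‖((k + 1 : ℕ) : K₁)‖, lt_min hθ0 (norm_pos_iff.2 (by exact_mod_cast k.succ_ne_zero)),
        fun i hi hi' => ?_⟩
      rcases Nat.le_succ_iff.1 hi with h | rfl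
      · exact (min_le_left _ _).trans (hθ i h hi')
      · exact min_le_right _ _
  set lam := ‖(P.a P.τ : K₁)‖ with hlam
  set μ := ‖(P.b P.τ : K₂)‖⁻¹ with hμ
  have hlam1 : 1 < lam := P.one_lt_norm_a_τ
  have hμ1 : 1 < μ := (one_lt_inv₀ (norm_pos_iff.2 (Units.ne_zero _))).2 P.norm_b_τ_lt_one
  obtain ⟨n₁, hn₁⟩ := pow_unbounded_of_one_lt (2 * k : ℝ) hμ1
  set m := max d (max (freeLength T) (freeLength A)) with hm
  set c' := max c 0 with hc'
  set C' := max C 0 with hC'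
  have hp : 0 < ‖P.X α‖ := norm_pos_iff.2 hXα
  have hq : 0 < ‖P.Y α‖ := norm_pos_iff.2 hYα
  -- In the strip `|h| ≤ c' * m` both linear parts are bounded by the maximum, so a generator moves
  -- each coordinate by at most `D`; the summand `1` makes `D` positive.
  set D := max (Real.exp (c' * m)) (Real.exp (c₁ * (c' * m) + c₂)) * C' + 1 with hD
  -- The half leaves room for the second coordinate of the upper conjugate: its multiples have norm
  -- at most `k * ‖P.Y α‖`, which is at most `μ ^ n * ‖P.Y α‖ / 2` once `n ≥ n₁`.
  refine ⟨4 ^ k * (4 * m + 4), max n₁ 1, D, min (θ * ‖P.X α‖) (‖P.Y α‖ / 2), min lam μ, by positivity,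
    by positivity, lt_min hlam1 hμ1, ?_⟩
  intro n hn ψ₁ ψ₂ ε ρ hε hρ h₁ h₂ hb₁ hb₂ hs₁ hs₂ hl₁ hl₂
  have hν : 0 ≤ min lam μ := (zero_le_one.trans (lt_min hlam1 hμ1).le)
  have hρ1 : ρ ≤ θ * ‖P.X α‖ * lam ^ n := hρ.trans (mul_le_mul (min_le_left _ _)
    (pow_le_pow_left₀ hν (min_le_left _ _) n) (by positivity) (by positivity))
  have hρ2 : ρ ≤ ‖P.Y α‖ / 2 * μ ^ n := hρ.trans (mul_le_mul (min_le_right _ _)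
    (pow_le_pow_left₀ hν (min_le_right _ _) n) (by positivity) (by positivity))
  have hμn : (2 * k : ℝ) ≤ μ ^ n :=
    hn₁.le.trans (pow_le_pow_right₀ hμ1.le (le_trans (le_max_left _ _) hn))
  have hconjX := affine_conj_pow P.X_mul P.X_τ α n
  have hconjY := affine_conj_pow P.Y_mul P.Y_τ α n
  have hdiff : ∀ g, |Real.log ‖(P.a g : K₁)‖| ≤ c' * m → ∀ s, ‖P.X s‖ ≤ C → ‖P.Y s‖ ≤ C →
      |ψ₁ (P.X (g * s)) * ψ₂ (P.Y (g * s)) - ψ₁ (P.X g) * ψ₂ (P.Y g)| ≤ 2 * ε := by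
    intro g hg s hsX hsY
    have e1 : ‖P.X (g * s) - P.X g‖ ≤ D := by
      rw [P.X_mul, add_sub_cancel_left, norm_mul]
      have : ‖(P.a g : K₁)‖ ≤ Real.exp (c' * m) := by
        rw [← Real.exp_log (norm_pos_iff.2 (P.a g).ne_zero)]
        exact Real.exp_le_exp.2 ((le_abs_self _).trans hg)
      calc _ ≤ max (Real.exp (c' * m)) (Real.exp (c₁ * (c' * m) + c₂)) * C' :=
            mul_le_mul (this.trans (le_max_left _ _)) (hsX.trans (le_max_left _ _))
              (norm_nonneg _) (by positivity)
        _ ≤ D := by rw [hD]; linarith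
    have e2 : ‖P.Y (g * s) - P.Y g‖ ≤ D := by
      rw [P.Y_mul, add_sub_cancel_left, norm_mul]
      have : ‖(P.b g : K₂)‖ ≤ Real.exp (c₁ * (c' * m) + c₂) := by
        rw [← Real.exp_log (norm_pos_iff.2 (P.b g).ne_zero)]
        refine Real.exp_le_exp.2 ((le_abs_self _).trans ((hc₂ g).trans ?_))
        gcongr
      calc _ ≤ max (Real.exp (c' * m)) (Real.exp (c₁ * (c' * m) + c₂)) * C' :=
            mul_le_mul (this.trans (le_max_right _ _)) (hsY.trans (le_max_left _ _))
              (norm_nonneg _) (by positivity)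
        _ ≤ D := by rw [hD]; linarith
    have f1 := hl₁ _ _ e1
    have f2 := hl₂ _ _ e2
    have : ψ₁ (P.X (g * s)) * ψ₂ (P.Y (g * s)) - ψ₁ (P.X g) * ψ₂ (P.Y g) =
        (ψ₁ (P.X (g * s)) - ψ₁ (P.X g)) * ψ₂ (P.Y (g * s)) +
          ψ₁ (P.X g) * (ψ₂ (P.Y (g * s)) - ψ₂ (P.Y g)) := by ring
    rw [this]
    calc _ ≤ _ := abs_add_le _ _
      _ = _ := by rw [abs_mul, abs_mul]
      _ ≤ ε * 1 + 1 * ε := add_le_add (mul_le_mul f1 (hb₂ _) (abs_nonneg _) hε)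
          (mul_le_mul (hb₁ _) f2 (abs_nonneg _) zero_le_one)
      _ = 2 * ε := by ring
  obtain ⟨w, hw, hwl, hwa⟩ := exists_relator_of_testFunction (S := S) (V := K₁ × K₂)
    (h := fun g => Real.log ‖(P.a g : K₁)‖) (pos := fun g => (P.X g, P.Y g)) (N := commutator G)
    (T := T) (A := A) (k := k) (c := c') (m := m) (d := d) (n := n)
    (f := fun v => ψ₁ v.1 * ψ₂ v.2) (ε := 2 * ε)
    (x := (P.a P.τ ^ n * P.X α, P.b P.τ ^ n * P.Y α))
    (y := (((P.a P.τ : K₁) ^ n)⁻¹ * P.X α, ((P.b P.τ : K₂) ^ n)⁻¹ * P.Y α))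
    (fun x y => by rw [map_mul, Units.val_mul, norm_mul, Real.log_mul (ha1 _) (ha1 _)])
    (fun g hg => by rw [hkera g hg]; simp)
    (fun g hg g' => by
      ext
      · simp [P.X_mul, hkera g hg]
      · simp [P.Y_mul, hkerb g hg])
    (by rw [hT]; exact Real.log_pos hlam1)
    (fun g => by simp [hT, P.X_mul, P.Y_mul, P.X_τ, P.Y_τ])
    (by rw [hA]; exact hαN) hk (le_max_right _ _)
    (fun s hs => (hcC s hs).1.trans (le_max_left _ _))
    ((le_max_left _ _).trans (le_max_right _ _)) ((le_max_right _ _).trans (le_max_right _ _))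
    (le_max_left _ _) (Nat.one_le_iff_ne_zero.1 ((le_max_right _ _).trans hn)) (by positivity)
    (fun g hg s hs => by
      obtain ⟨-, i1, i2, i3, i4⟩ := hcC s hs
      exact ⟨hdiff g hg s i1 i3, hdiff g hg s⁻¹ i2 i4⟩)
    (by rw [hT, hA, hconjX.1, hconjY.1]) (by rw [hT, hA, hconjX.2, hconjY.2])
    (by simp [h₁, h₂])
    (fun i hi hi' => by
      have : ψ₁ (i • (P.a P.τ ^ n * P.X α)) = 0 := by
        apply hs₁
        rw [nsmul_eq_mul, norm_mul, norm_mul, norm_pow, ← hlam]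
        calc ρ ≤ _ := hρ1
          _ = θ * (lam ^ n * ‖P.X α‖) := by ring
          _ ≤ _ := mul_le_mul_of_nonneg_right (hθ i hi hi') (by positivity)
      simp only [Prod.smul_fst, this, zero_mul])
    (fun i hi => by
      have : ψ₂ (i • (P.b P.τ ^ n * P.Y α) + ((P.b P.τ : K₂) ^ n)⁻¹ * P.Y α) = 0 := by
        apply hs₂
        have e1 : ‖((P.b P.τ : K₂) ^ n)⁻¹ * P.Y α‖ = μ ^ n * ‖P.Y α‖ := by
          rw [norm_mul, norm_inv, norm_pow, hμ, inv_pow]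
        have e2 : ‖i • (P.b P.τ ^ n * P.Y α)‖ ≤ k * ‖P.Y α‖ := by
          rw [nsmul_eq_mul, norm_mul, norm_mul, norm_pow]
          calc _ ≤ (k : ℝ) * (1 * ‖P.Y α‖) := by
                refine mul_le_mul ((norm_natCast_le K₂ i).trans (by exact_mod_cast hi)) ?_
                  (by positivity) (by positivity)
                exact mul_le_mul_of_nonneg_right (pow_le_one₀ (norm_nonneg _)
                  P.norm_b_τ_lt_one.le) (norm_nonneg _)
            _ = _ := by ring
        have e3 := norm_sub_le_norm_add (((P.b P.τ : K₂) ^ n)⁻¹ * P.Y α)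
          (i • (P.b P.τ ^ n * P.Y α))
        rw [add_comm]
        refine le_trans ?_ e3
        rw [e1]
        nlinarith
      simp only [Prod.snd_add, Prod.smul_snd, this, mul_zero])
  refine ⟨w, hw, hwl.trans ?_, fun l hl hlw => (hwa l hl hlw).trans ?_⟩
  · rw [mul_assoc]
    refine Nat.mul_le_mul_left _ ?_
    rw [mul_comm]
    exact Nat.mul_le_mul_right _ (by omega)
  · have h4 : (1 : ℝ) ≤ 4 ^ k := one_le_pow₀ (by norm_num)
    push_cast
    have hm0 : (0 : ℝ) ≤ m := Nat.cast_nonneg _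
    have h5 : (4 : ℝ) ^ k ≤ 4 ^ k * (4 * m + 4) := le_mul_of_one_le_right (by positivity) (by linarith)
    have h6 : 2 * (2 * ε) * m ≤ 4 ^ k * (4 * m + 4) * ε := by
      calc 2 * (2 * ε) * m ≤ 1 * (4 * m + 4) * ε := by nlinarith
        _ ≤ _ := by gcongr
    refine mul_le_mul ?_ h6 (by positivity) (by positivity)
    gcongr

end SOLCoordinates

end Coordinates

/-! ### From areas of words to the Dehn function. -/

section Dehn

theorem exists_list_of_area_le {G : Type*} [Group G] {R : Set G} {w : G} {N : ℕ}
    (h : area R w ≤ N) : ∃ l : List G, (∀ x ∈ l, x ∈ Group.conjugatesOfSet R ∨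
      x⁻¹ ∈ Group.conjugatesOfSet R) ∧ l.prod = w ∧ l.length ≤ N := by
  have h1 : area R w < ((N + 1 : ℕ) : ℕ∞) := h.trans_lt (by exact_mod_cast N.lt_succ_self)
  unfold area wordLength at h1
  obtain ⟨⟨l, hl, hlw⟩, hlN⟩ := iInf_lt_iff.1 h1
  exact ⟨l, hl, hlw, Nat.lt_succ_iff.1 (by exact_mod_cast hlN)⟩

/-- A group whose areas grow exponentially along a sequence of words of linear length has an
at least exponential Dehn function. -/
theorem biAsymptoticallyBounded_exp_of_words {G : Type*} [Group G] {S : Set G} {d : ℕ}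
    {M n₀ : ℕ} {κ ν : ℝ} (hκ : 0 < κ) (hν : 1 < ν)
    (hw : ∀ n ≥ n₀, ∃ w ∈ (freeProj S).ker, freeLength w ≤ M * (2 * n + 1) ∧
      ∀ l : List (FreeGroup S), (∀ z ∈ l, z ∈ Group.conjugatesOfSet (relators S d) ∨
        z⁻¹ ∈ Group.conjugatesOfSet (relators S d)) → l.prod = w →
        κ * ν ^ n ≤ l.length + M * (2 * n + 1)) :
    BiAsymptoticallyBounded (fun n => ENNReal.ofReal (Real.exp n))
      (fun n => (dehnFunction S d n : ℝ≥0∞)) := by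
  -- Passing to the words of index `J * n` turns the growth rate `ν` into at least `e`.
  obtain ⟨J, hJ⟩ := pow_unbounded_of_one_lt (Real.exp 1) hν
  have hJ0 : J ≠ 0 := by
    rintro rfl
    rw [pow_zero] at hJ
    have := Real.add_one_le_exp (1 : ℝ)
    linarith
  obtain ⟨C₁, hC₁⟩ := exists_nat_ge (2 / κ)
  obtain ⟨C₂, hC₂⟩ := exists_nat_ge (Real.exp (n₀ + 1 : ℕ))
  refine ⟨C₁ + C₂ + 2 * (M * (2 * J + 1)) + 1, by omega, fun n => ?_⟩
  set C := C₁ + C₂ + 2 * (M * (2 * J + 1)) + 1 with hC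
  by_cases hn : n ≤ n₀ + 1
  · calc ENNReal.ofReal (Real.exp n) ≤ ENNReal.ofReal (C : ℝ) := by
          refine ENNReal.ofReal_le_ofReal ?_
          have h1 : Real.exp n ≤ Real.exp (n₀ + 1 : ℕ) := Real.exp_le_exp.2 (by exact_mod_cast hn)
          have h2 : (C₂ : ℝ) ≤ C := by exact_mod_cast (by omega)
          linarith
      _ = C := ENNReal.ofReal_natCast C
      _ ≤ _ := le_add_self
  · rcases eq_or_ne (dehnFunction S d (C * n)) ⊤ with htop | htop
    · simp only [htop]
      rw [ENat.toENNReal_top, ENNReal.mul_top (by exact_mod_cast (by omega : C ≠ 0)), top_add]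
      exact le_top
    · obtain ⟨N, hN⟩ := ENat.ne_top_iff_exists.1 htop
      obtain ⟨w, hw1, hw2, hw3⟩ := hw (J * n)
        (le_trans (by omega) (Nat.le_mul_of_pos_left n (Nat.pos_of_ne_zero hJ0)))
      have hlin : 2 * (M * (2 * (J * n) + 1)) ≤ C * n := by
        calc 2 * (M * (2 * (J * n) + 1)) ≤ 2 * (M * (2 * (J * n) + n)) := by
              gcongr; omega
          _ = 2 * (M * (2 * J + 1)) * n := by ring
          _ ≤ C * n := Nat.mul_le_mul_right _ (by omega)
      -- The term `n / 2` in the Dehn function absorbs the linear correction; this is where the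
      -- factor `2` in `C` comes from.
      have hN1 : M * (2 * (J * n) + 1) ≤ N := by
        have : ((C * n / 2 : ℕ) : ℕ∞) ≤ N := by
          rw [hN]; exact le_max_left _ _
        have : C * n / 2 ≤ N := by exact_mod_cast this
        omega
      have hN2 : area (relators S d) w ≤ N := by
        rw [hN]
        refine le_trans ?_ (le_max_right _ _)
        exact le_iSup (fun w : {w : FreeGroup S // w ∈ (freeProj S).ker ∧ freeLength w ≤ C * n} =>
          area (relators S d) w.1) ⟨w, hw1, by omega⟩
      obtain ⟨l, hl, hlw, hlN⟩ := exists_list_of_area_le hN2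
      have h1 := hw3 l hl hlw
      have h2 : Real.exp n ≤ ν ^ (J * n) := by
        rw [pow_mul, ← Real.exp_one_pow]
        exact pow_le_pow_left₀ (Real.exp_nonneg _) hJ.le n
      have h3 : (l.length : ℝ) ≤ N := by exact_mod_cast hlN
      have h4 : (M * (2 * (J * n : ℕ) + 1) : ℝ) ≤ N := by exact_mod_cast hN1
      have h5 : κ * Real.exp n ≤ 2 * N := by
        calc _ ≤ κ * ν ^ (J * n) := mul_le_mul_of_nonneg_left h2 hκ.le
          _ ≤ _ := by linarith
      have h6 : Real.exp n ≤ C * N := by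
        calc Real.exp n ≤ 2 / κ * N := by
              rw [div_mul_eq_mul_div, le_div_iff₀ hκ]; linarith
          _ ≤ C * N := by
              refine mul_le_mul_of_nonneg_right (hC₁.trans ?_) (Nat.cast_nonneg _)
              exact_mod_cast (by omega)
      calc ENNReal.ofReal (Real.exp n) ≤ ENNReal.ofReal ((C * N : ℕ) : ℝ) :=
            ENNReal.ofReal_le_ofReal (by push_cast; exact h6)
        _ = C * (N : ℝ≥0∞) := by rw [ENNReal.ofReal_natCast]; push_cast; rfl
        _ = C * ((dehnFunction S d (C * n) : ℕ∞) : ℝ≥0∞) := by rw [← hN]; simp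
        _ ≤ _ := le_self_add

end Dehn

/-! ### Choice of profiles: tents in general, balls in the ultrametric case. -/

namespace SOLCoordinates

variable {G K₁ K₂ : Type*} [Group G] [NontriviallyNormedField K₁] [NontriviallyNormedField K₂]
  {P : SOLCoordinates G K₁ K₂}

theorem abs_tent_sub_le {K : Type*} [NormedField K] {ρ D : ℝ} (hρ : 0 < ρ) {x y : K}
    (h : ‖x - y‖ ≤ D) : |max (1 - ‖x‖ / ρ) 0 - max (1 - ‖y‖ / ρ) 0| ≤ D / ρ := by
  refine (abs_max_sub_max_le_abs _ _ _).trans ?_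
  rw [show 1 - ‖x‖ / ρ - (1 - ‖y‖ / ρ) = -((‖x‖ - ‖y‖) / ρ) by ring, abs_neg, abs_div,
    abs_of_pos hρ]
  exact div_le_div_of_nonneg_right ((abs_norm_sub_norm_le x y).trans h) hρ.le

theorem abs_tent_le {K : Type*} [NormedField K] {ρ : ℝ} (hρ : 0 < ρ) (x : K) :
    |max (1 - ‖x‖ / ρ) 0| ≤ 1 := by
  have : 0 ≤ ‖x‖ / ρ := by positivity
  rw [abs_of_nonneg (le_max_right _ _)]
  exact max_le (by linarith) zero_le_one

theorem tent_eq_zero {K : Type*} [NormedField K] {ρ : ℝ} (hρ : 0 < ρ) (x : K) (h : ρ ≤ ‖x‖) :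
    max (1 - ‖x‖ / ρ) 0 = 0 := by
  have : 1 ≤ ‖x‖ / ρ := (one_le_div hρ).2 h
  exact max_eq_right (by linarith)

/-- Tents of radius `κ * ν ^ n` have slope the inverse of the radius, so `ε` decays like `ν ^ (-n)`.
-/
theorem IsBoundedOn.biAsymptoticallyBounded_exp {S : Set G} (hS : P.IsBoundedOn S)
    (hgen : Subgroup.closure S = ⊤) [CharZero K₁] [Group.IsNilpotent (commutator G)] (d : ℕ) :
    BiAsymptoticallyBounded (fun n => ENNReal.ofReal (Real.exp n))
      (fun n => (dehnFunction S d n : ℝ≥0∞)) := by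
  obtain ⟨M, n₀, D, κ, ν, hD, hκ, hν, H⟩ := hS.exists_relator hgen d
  refine biAsymptoticallyBounded_exp_of_words (M := M) (n₀ := n₀) (κ := κ / ((M + 1) * D))
    (by positivity) hν fun n hn => ?_
  have hρ : 0 < κ * ν ^ n := by positivity
  obtain ⟨w, hw1, hw2, hw3⟩ := H n hn (fun x => max (1 - ‖x‖ / (κ * ν ^ n)) 0)
    (fun x => max (1 - ‖x‖ / (κ * ν ^ n)) 0) (D / (κ * ν ^ n)) (κ * ν ^ n) (by positivity) le_rfl
    (by simp) (by simp) (abs_tent_le hρ) (abs_tent_le hρ) (tent_eq_zero hρ) (tent_eq_zero hρ)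
    (fun _ _ => abs_tent_sub_le hρ) (fun _ _ => abs_tent_sub_le hρ)
  refine ⟨w, hw1, hw2, fun l hl hlw => ?_⟩
  have h1 := hw3 l hl hlw
  rw [div_mul_eq_mul_div, div_le_iff₀ (by positivity)]
  rw [← mul_div_assoc, ← mul_div_assoc, le_div_iff₀ hρ, one_mul] at h1
  refine h1.trans ?_
  gcongr
  linarith

open Classical in
theorem abs_ball_indicator_sub_le {K : Type*} [NormedField K] [IsUltrametricDist K] {ρ D : ℝ}
    (hρ : D < ρ) {x y : K} (h : ‖x - y‖ ≤ D) :
    |(if ‖x‖ < ρ then (1 : ℝ) else 0) - (if ‖y‖ < ρ then 1 else 0)| ≤ 0 := by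
  have : ‖x‖ < ρ ↔ ‖y‖ < ρ := by
    constructor
    · intro hx
      have := IsUltrametricDist.norm_add_le_max x (-(x - y))
      rw [norm_neg, ← sub_eq_add_neg, sub_sub_cancel] at this
      exact this.trans_lt (max_lt hx (h.trans_lt hρ))
    · intro hy
      have := IsUltrametricDist.norm_add_le_max (x - y) y
      rw [sub_add_cancel] at this
      exact this.trans_lt (max_lt (h.trans_lt hρ) hy)
  simp [this]

-- The indicator of a ball of radius `D + 1` is unchanged by displacements of size `D`, so the
-- estimate holds with `ε = 0` and reads `1 ≤ 0` for any expression of the word as a product of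
-- conjugates of relators.
open Classical in
theorem IsBoundedOn.normalClosure_relators_ne {S : Set G} (hS : P.IsBoundedOn S)
    (hgen : Subgroup.closure S = ⊤) [CharZero K₁] [IsUltrametricDist K₁] [IsUltrametricDist K₂]
    [Group.IsNilpotent (commutator G)] (d : ℕ) :
    Subgroup.normalClosure (relators S d) ≠ (freeProj S).ker := by
  intro hcl
  obtain ⟨M, n₀, D, κ, ν, hD, hκ, hν, H⟩ := hS.exists_relator hgen d
  obtain ⟨n₁, hn₁⟩ := pow_unbounded_of_one_lt ((D + 1) / κ) hν
  have hρ : D + 1 ≤ κ * ν ^ (max n₀ n₁) := by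
    rw [div_lt_iff₀ hκ, mul_comm] at hn₁
    exact hn₁.le.trans (mul_le_mul_of_nonneg_left
      (pow_le_pow_right₀ hν.le (le_max_right _ _)) hκ.le)
  have hb : ∀ p : Prop, |(if p then (1 : ℝ) else 0)| ≤ 1 := by
    intro p; split_ifs <;> simp
  obtain ⟨w, hw1, -, hw3⟩ := H (max n₀ n₁) (le_max_left _ _)
    (fun x => if ‖x‖ < D + 1 then 1 else 0) (fun x => if ‖x‖ < D + 1 then 1 else 0) 0 (D + 1)
    le_rfl hρ (by rw [norm_zero, if_pos (by linarith)]) (by rw [norm_zero, if_pos (by linarith)])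
    (fun _ => hb _) (fun _ => hb _)
    (fun _ h => if_neg (not_lt.2 h)) (fun _ h => if_neg (not_lt.2 h))
    (fun _ _ => abs_ball_indicator_sub_le (by linarith))
    (fun _ _ => abs_ball_indicator_sub_le (by linarith))
  rw [← hcl] at hw1
  rw [Subgroup.normalClosure, ← Subgroup.mem_toSubmonoid, Subgroup.closure_toSubmonoid] at hw1
  obtain ⟨l, hl, hlw⟩ := Submonoid.exists_list_of_mem_closure hw1
  have := hw3 l hl hlw
  rw [mul_zero, mul_zero] at this
  linarith

end SOLCoordinates

/-! ### Groups of SOL type provide the coordinates. -/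

section SOLGroup

variable {K₁ K₂ : Type*} [NontriviallyNormedField K₁] [NontriviallyNormedField K₂]

theorem continuous_log_norm_units {K : Type*} [NontriviallyNormedField K] :
    Continuous fun x : Kˣ => Real.log ‖(x : K)‖ :=
  Units.continuous_val.norm.log fun x => norm_ne_zero_iff.2 x.ne_zero

/-- In the acting group of a group of SOL type, the moduli of the two coordinates control each
other. -/
theorem IsSOLType.abs_log_norm_le {E : Subgroup (K₁ˣ × K₂ˣ)} (hE : IsSOLType E) :
    ∃ c₁ c₂ : ℝ, 0 ≤ c₁ ∧ ∀ e ∈ E,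
      |Real.log ‖(e.2 : K₂)‖| ≤ c₁ * |Real.log ‖(e.1 : K₁)‖| + c₂ := by
  obtain ⟨-, t, htE, ht1, -, hcomp⟩ := hE
  have hlog1 : ∀ x y : K₁ˣ, Real.log ‖((x * y : K₁ˣ) : K₁)‖ =
      Real.log ‖(x : K₁)‖ + Real.log ‖(y : K₁)‖ := fun x y => by
    rw [Units.val_mul, norm_mul, Real.log_mul (norm_ne_zero_iff.2 x.ne_zero)
      (norm_ne_zero_iff.2 y.ne_zero)]
  have hlog2 : ∀ x y : K₂ˣ, Real.log ‖((x * y : K₂ˣ) : K₂)‖ =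
      Real.log ‖(x : K₂)‖ + Real.log ‖(y : K₂)‖ := fun x y => by
    rw [Units.val_mul, norm_mul, Real.log_mul (norm_ne_zero_iff.2 x.ne_zero)
      (norm_ne_zero_iff.2 y.ne_zero)]
  let U : ℕ → Set E := fun N =>
    {e | |Real.log ‖(e.1.1 : K₁)‖| < N} ∩ {e | |Real.log ‖(e.1.2 : K₂)‖| < N}
  have hU : ∀ N, IsOpen (U N) := fun N => by
    refine IsOpen.inter (isOpen_lt ?_ continuous_const) (isOpen_lt ?_ continuous_const)
    · exact (continuous_log_norm_units.comp (continuous_fst.comp continuous_subtype_val)).abs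
    · exact (continuous_log_norm_units.comp (continuous_snd.comp continuous_subtype_val)).abs
  obtain ⟨N, hN⟩ := isCompact_univ.elim_directed_cover
    (fun N => ((↑) : E → E ⧸ (Subgroup.zpowers t).subgroupOf E) '' U N)
    (fun N => QuotientGroup.isOpenMap_coe _ (hU N))
    (fun q _ => by
      obtain ⟨e, rfl⟩ := QuotientGroup.mk_surjective q
      obtain ⟨N, hN⟩ := exists_nat_gt (max |Real.log ‖(e.1.1 : K₁)‖| |Real.log ‖(e.1.2 : K₂)‖|)
      exact Set.mem_iUnion.2 ⟨N, e, ⟨(le_max_left _ _).trans_lt hN, (le_max_right _ _).trans_lt hN⟩,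
        rfl⟩)
    (directed_of_isDirected_le fun i j hij => Set.image_mono fun e he => by
      have hij' : (i : ℝ) ≤ j := by exact_mod_cast hij
      have h1 : |Real.log ‖(e.1.1 : K₁)‖| < j := lt_of_lt_of_le he.1 hij'
      have h2 : |Real.log ‖(e.1.2 : K₂)‖| < j := lt_of_lt_of_le he.2 hij'
      exact ⟨h1, h2⟩)
  set p := Real.log ‖(t.1 : K₁)‖ with hp
  set q := Real.log ‖(t.2 : K₂)‖ with hq
  have hp0 : 0 < p := Real.log_pos ht1
  -- Write `e = u * t ^ k` with `u` in `U N`: both logarithms are, up to `N`, `k` times those of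
  -- `t`, so their ratio is about `q / p`.
  refine ⟨|q| / p, |q| / p * N + N, by positivity, fun e he => ?_⟩
  obtain ⟨u, hu, hue⟩ := hN (Set.mem_univ ((⟨e, he⟩ : E) : E ⧸ (Subgroup.zpowers t).subgroupOf E))
  obtain ⟨k, hk⟩ := Subgroup.mem_zpowers_iff.1 (Subgroup.mem_subgroupOf.1 (QuotientGroup.eq.1 hue))
  have hk' : e = u.1 * t ^ k := by
    rw [hk]
    simp
  have e1 : Real.log ‖(e.1 : K₁)‖ = Real.log ‖(u.1.1 : K₁)‖ + k * p := by
    rw [hk', Prod.fst_mul, hlog1, Prod.pow_fst, Units.val_zpow_eq_zpow_val, norm_zpow, Real.log_zpow]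
  have e2 : Real.log ‖(e.2 : K₂)‖ = Real.log ‖(u.1.2 : K₂)‖ + k * q := by
    rw [hk', Prod.snd_mul, hlog2, Prod.pow_snd, Units.val_zpow_eq_zpow_val, norm_zpow, Real.log_zpow]
  have h1 : |Real.log ‖(u.1.1 : K₁)‖| ≤ N := le_of_lt hu.1
  have h2 : |Real.log ‖(u.1.2 : K₂)‖| ≤ N := le_of_lt hu.2
  have h3 : |(k : ℝ)| * p ≤ |Real.log ‖(e.1 : K₁)‖| + N := by
    have : (k : ℝ) * p = Real.log ‖(e.1 : K₁)‖ - Real.log ‖(u.1.1 : K₁)‖ := by rw [e1]; ring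
    calc |(k : ℝ)| * p = |(k : ℝ) * p| := by rw [abs_mul, abs_of_pos hp0]
      _ ≤ _ := by rw [this]; exact (abs_sub _ _).trans (by linarith)
  rw [e2]
  calc _ ≤ _ := abs_add_le _ _
    _ ≤ N + |q| / p * (|(k : ℝ)| * p) := by
        rw [abs_mul]
        refine add_le_add h2 (le_of_eq ?_)
        field_simp
    _ ≤ N + |q| / p * (|Real.log ‖(e.1 : K₁)‖| + N) := by gcongr
    _ = _ := by ring

variable {G : Type*} [Group G] [TopologicalSpace G] [IsTopologicalGroup G]

/-- A continuous homomorphism with dense image to a group of SOL type provides coordinates that are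
bounded on compact subsets. -/
theorem IsSOLType.exists_solCoordinates {E : Subgroup (K₁ˣ × K₂ˣ)} (hE : IsSOLType E)
    {f : G →* SOLGroup E} (hf : Continuous f) (hd : DenseRange f) :
    ∃ P : SOLCoordinates G K₁ K₂, ∀ S : Set G, IsCompact S → P.IsBoundedOn S := by
  obtain ⟨c₁, c₂, hc₁, hc₂⟩ := hE.abs_log_norm_le
  obtain ⟨-, t, htE, ht1, ht2, -⟩ := hE
  have hind : Continuous fun g : SOLGroup E => (g.left, g.right) := continuous_induced_dom
  have hleft : Continuous fun g : SOLGroup E => g.left.toAdd :=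
    continuous_toAdd.comp (continuous_fst.comp hind)
  have hright : Continuous fun g : SOLGroup E => g.right.1 :=
    continuous_subtype_val.comp (continuous_snd.comp hind)
  have hr1 : Continuous fun g : SOLGroup E => (g.right.1.1 : K₁) :=
    Units.continuous_val.comp (continuous_fst.comp hright)
  have hr2 : Continuous fun g : SOLGroup E => (g.right.1.2 : K₂) :=
    Units.continuous_val.comp (continuous_snd.comp hright)
  obtain ⟨τ, hτ1, hτ2⟩ : ∃ τ, 1 < ‖((f τ).right.1.1 : K₁)‖ ∧ ‖((f τ).right.1.2 : K₂)‖ < 1 := by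
    have ho : IsOpen ({g : SOLGroup E | 1 < ‖(g.right.1.1 : K₁)‖} ∩
        {g : SOLGroup E | ‖(g.right.1.2 : K₂)‖ < 1}) :=
      (isOpen_lt continuous_const hr1.norm).inter (isOpen_lt hr2.norm continuous_const)
    exact hd.exists_mem_open ho ⟨SemidirectProduct.inr ⟨t, htE⟩, ht1, ht2⟩
  -- The fixed points `p`, `q` of the affine maps given by `f τ` become the origins: `X g` is the
  -- displacement of `p` by `g`.
  set p : K₁ := (f τ).left.toAdd.1 / (1 - (f τ).right.1.1) with hp
  set q : K₂ := (f τ).left.toAdd.2 / (1 - (f τ).right.1.2) with hq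
  have hτ1' : (1 : K₁) - (f τ).right.1.1 ≠ 0 := by
    intro h
    rw [← sub_eq_zero.1 h, norm_one] at hτ1
    exact hτ1.false
  have hτ2' : (1 : K₂) - (f τ).right.1.2 ≠ 0 := by
    intro h
    rw [← sub_eq_zero.1 h, norm_one] at hτ2
    exact hτ2.false
  have hX : Continuous fun g : SOLGroup E => g.left.toAdd.1 + g.right.1.1 * p - p :=
    ((continuous_fst.comp hleft).add (hr1.mul continuous_const)).sub continuous_const
  have hY : Continuous fun g : SOLGroup E => g.left.toAdd.2 + g.right.1.2 * q - q :=
    ((continuous_snd.comp hleft).add (hr2.mul continuous_const)).sub continuous_const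
  let P : SOLCoordinates G K₁ K₂ :=
    { a := (MonoidHom.fst _ _).comp (E.subtype.comp (SemidirectProduct.rightHom.comp f))
      b := (MonoidHom.snd _ _).comp (E.subtype.comp (SemidirectProduct.rightHom.comp f))
      X := fun g => (f g).left.toAdd.1 + (f g).right.1.1 * p - p
      Y := fun g => (f g).left.toAdd.2 + (f g).right.1.2 * q - q
      X_mul := fun g h => by
        change _ = _ + ((f g).right.1.1 : K₁) * _
        simp [solAction]
        ring
      Y_mul := fun g h => by
        change _ = _ + ((f g).right.1.2 : K₂) * _
        simp [solAction]
        ring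
      τ := τ
      X_τ := by rw [hp]; field_simp; ring
      Y_τ := by rw [hq]; field_simp; ring
      one_lt_norm_a_τ := hτ1
      norm_b_τ_lt_one := hτ2
      exists_ne_zero := by
        have ho := (isOpen_ne_fun hX (continuous_const (y := (0 : K₁)))).inter
          (isOpen_ne_fun hY (continuous_const (y := (0 : K₂))))
        exact hd.exists_mem_open ho
          ⟨SemidirectProduct.inl (Multiplicative.ofAdd (1, 1)), by simp, by simp⟩
      abs_log_norm_b_le := ⟨c₁, c₂, hc₁, fun g => hc₂ _ (f g).right.2⟩ }
  refine ⟨P, fun S hS => ?_⟩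
  have hXf : Continuous P.X := hX.comp hf
  have hYf : Continuous P.Y := hY.comp hf
  have haf : Continuous fun g => Real.log ‖(P.a g : K₁)‖ :=
    continuous_log_norm_units.comp ((continuous_fst.comp hright).comp hf)
  obtain ⟨c, hc⟩ := hS.exists_bound_of_continuousOn haf.continuousOn
  obtain ⟨C₁, hC₁⟩ := hS.exists_bound_of_continuousOn hXf.continuousOn
  obtain ⟨C₂, hC₂⟩ := hS.exists_bound_of_continuousOn (hXf.comp continuous_inv).continuousOn
  obtain ⟨C₃, hC₃⟩ := hS.exists_bound_of_continuousOn hYf.continuousOn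
  obtain ⟨C₄, hC₄⟩ := hS.exists_bound_of_continuousOn (hYf.comp continuous_inv).continuousOn
  refine ⟨c, max (max C₁ C₂) (max C₃ C₄), fun s hs => ⟨hc s hs, ?_, ?_, ?_, ?_⟩⟩
  · exact (hC₁ s hs).trans ((le_max_left _ _).trans (le_max_left _ _))
  · exact (hC₂ s hs).trans ((le_max_right _ _).trans (le_max_left _ _))
  · exact (hC₃ s hs).trans ((le_max_left _ _).trans (le_max_right _ _))
  · exact (hC₄ s hs).trans ((le_max_right _ _).trans (le_max_right _ _))

theorem HasSOLObstruction.biAsymptoticallyBounded_exp {G : Type v} [Group G] [TopologicalSpace G]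
    [IsTopologicalGroup G] [Group.IsNilpotent (commutator G)] (hG : HasSOLObstruction.{w, v} G)
    (S : Set G) (hS : IsCompactGeneratingSet S) (d : ℕ) :
    BiAsymptoticallyBounded (fun n => ENNReal.ofReal (Real.exp n))
      (fun n => (dehnFunction S d n : ℝ≥0∞)) := by
  obtain ⟨K₁, K₂, _, _, _, _, _, _, E, f, hE, hf, hd⟩ := hG
  obtain ⟨P, hP⟩ := hE.exists_solCoordinates hf hd
  exact (hP S hS.1).biAsymptoticallyBounded_exp hS.2 d

theorem HasNonArchimedeanSOLObstruction.not_isCompactlyPresented {G : Type v} [Group G]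
    [TopologicalSpace G] [IsTopologicalGroup G] [Group.IsNilpotent (commutator G)]
    (hG : HasNonArchimedeanSOLObstruction.{w, v} G) : ¬ IsCompactlyPresented G := by
  obtain ⟨K₁, K₂, _, _, _, _, _, _, _, _, E, f, hE, hf, hd⟩ := hG
  obtain ⟨P, hP⟩ := hE.exists_solCoordinates hf hd
  rintro ⟨S, hS, d, h⟩
  exact (hP S hS.1).normalClosure_relators_ne hS.2 d h

end SOLGroup

/-! ### Compact generation. -/

section CompactGeneration

instance Matrix.GeneralLinearGroup.sigmaCompactSpace {K : Type*} [NontriviallyNormedField K]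
    [LocallyCompactSpace K] (m : ℕ) : SigmaCompactSpace (Matrix.GeneralLinearGroup (Fin m) K) := by
  have : ProperSpace K := ProperSpace.of_locallyCompactSpace K
  have h1 : SigmaCompactSpace (Matrix (Fin m) (Fin m) K) :=
    inferInstanceAs (SigmaCompactSpace (Fin m → Fin m → K))
  have h2 : SigmaCompactSpace (Matrix (Fin m) (Fin m) K)ᵐᵒᵖ :=
    MulOpposite.opHomeomorph.symm.isClosedEmbedding.sigmaCompactSpace
  exact Units.isClosedEmbedding_embedProduct.sigmaCompactSpace

theorem IsUnipotentAlgebraic.sigmaCompactSpace {K : Type*} [NontriviallyNormedField K]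
    [LocallyCompactSpace K] {m : ℕ} {H : Subgroup (Matrix.GeneralLinearGroup (Fin m) K)}
    (hH : IsUnipotentAlgebraic H) : SigmaCompactSpace H := by
  obtain ⟨-, P, hP⟩ := hH
  have : IsClosed (H : Set (Matrix.GeneralLinearGroup (Fin m) K)) := by
    have : (H : Set (Matrix.GeneralLinearGroup (Fin m) K)) = ⋂ p ∈ P, {g : Matrix.GeneralLinearGroup (Fin m) K | MvPolynomial.eval
        (fun ij => (g : Matrix (Fin m) (Fin m) K) ij.1 ij.2) p = 0} := by
      ext g
      simp [hP g]
    rw [this]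
    refine isClosed_biInter fun p _ => isClosed_eq ((MvPolynomial.continuous_eval p).comp ?_)
      continuous_const
    exact continuous_pi fun ij => Units.continuous_val.matrix_elem ij.1 ij.2
  exact this.isClosedEmbedding_subtypeVal.sigmaCompactSpace

/-- A continuous surjective homomorphism from a `σ`-compact group to `K ^ r` maps some compact subset
onto a neighborhood of the origin. -/
theorem exists_isCompact_ball_subset_image {K : Type*} [NontriviallyNormedField K]
    [LocallyCompactSpace K] {U : Type*} [Group U] [TopologicalSpace U] [IsTopologicalGroup U]
    [SigmaCompactSpace U] {r : ℕ} {π : U →* Multiplicative (Fin r → K)} (hπ : Continuous π)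
    (hsurj : Function.Surjective π) :
    ∃ S : Set U, IsCompact S ∧ ∃ ε > 0, ∀ x : Fin r → K, ‖x‖ < ε → ∃ u ∈ S, (π u).toAdd = x := by
  have : ProperSpace K := ProperSpace.of_locallyCompactSpace K
  have hc : Continuous fun u => (π u).toAdd := continuous_toAdd.comp hπ
  -- By Baire, some compact set of the covering has an image with interior; quotients of its
  -- elements then cover a ball at the origin.
  obtain ⟨n, x₀, hx₀⟩ := nonempty_interior_of_iUnion_of_closed
    (f := fun n => (fun u => (π u).toAdd) '' compactCovering U n)
    (fun n => ((isCompact_compactCovering U n).image hc).isClosed)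
    (by
      rw [← Set.image_iUnion, iUnion_compactCovering, Set.image_univ]
      exact (Multiplicative.toAdd.surjective.comp hsurj).range_eq)
  obtain ⟨ε, hε, hball⟩ := Metric.mem_nhds_iff.1 (mem_interior_iff_mem_nhds.1 hx₀)
  have hK := isCompact_compactCovering U n
  refine ⟨_, (hK.prod hK).image (f := fun p : U × U => p.1 * p.2⁻¹) (by fun_prop), ε, hε,
    fun x hx => ?_⟩
  obtain ⟨u, hu, hux⟩ := hball (show x₀ + x ∈ Metric.ball x₀ ε by simpa using hx)
  obtain ⟨u', hu', hux'⟩ := hball (Metric.mem_ball_self hε)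
  refine ⟨u * u'⁻¹, ⟨(u, u'), ⟨hu, hu'⟩, rfl⟩, ?_⟩
  simp only at hux hux'
  rw [map_mul, map_inv, toAdd_mul, toAdd_inv, hux, hux']
  abel

theorem IsUnipotentAlgebraic.isNilpotent {K : Type*} [Field K] {m : ℕ}
    {H : Subgroup (Matrix.GeneralLinearGroup (Fin m) K)} (hH : IsUnipotentAlgebraic H) :
    Group.IsNilpotent H :=
  Subgroup.isNilpotent_of_isUnitriangular hH.1

/-- Invariant subgroups of the factors of a standard solvable group containing a suitable compact
subset are everything. -/
theorem HasNoModulusOneQuotient.subgroup_eq_top {K : Type*} [NontriviallyNormedField K]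
    [LocallyCompactSpace K] {A U : Type*} [Group A] [Group U] [Group.IsNilpotent U]
    {φ : A →* MulAut U} {r : ℕ} {π : U →* Multiplicative (Fin r → K)}
    (hker : π.ker = commutator U) {ρ : Representation K A (Fin r → K)}
    (hφ : ∀ a u, (π (φ a u)).toAdd = ρ a (π u).toAdd) (hρ : HasNoModulusOneQuotient ρ)
    {ε : ℝ} (hε : 0 < ε) {H : Subgroup U} (hH : ∀ a, ∀ u ∈ H, φ a u ∈ H)
    (hball : ∀ x : Fin r → K, ‖x‖ < ε → ∃ u ∈ H, (π u).toAdd = x) : H = ⊤ := by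
  have h1 : (Subgroup.toAddSubgroup (H.map π)).map
      (AddEquiv.additiveMultiplicative (Fin r → K)).toAddMonoidHom = ⊤ := by
    refine hρ.eq_top_of_invariant ?_ hε ?_
    · rintro a _ ⟨_, ⟨u, hu, rfl⟩, rfl⟩
      exact ⟨Additive.ofMul (π (φ a u)), ⟨_, hH a u hu, rfl⟩, hφ a u⟩
    · intro x hx
      obtain ⟨u, hu, rfl⟩ := hball x hx
      exact ⟨Additive.ofMul (π u), ⟨_, hu, rfl⟩, rfl⟩
  refine H.eq_top_of_sup_commutator_eq_top ((Subgroup.eq_top_iff' _).2 fun u => ?_)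
  have h2 : (π u).toAdd ∈ (Subgroup.toAddSubgroup (H.map π)).map
      (AddEquiv.additiveMultiplicative (Fin r → K)).toAddMonoidHom := by
    rw [h1]
    trivial
  obtain ⟨_, ⟨y, hy, rfl⟩, hyu⟩ := h2
  have hyu : π y = π u := hyu
  have h3 : y⁻¹ * u ∈ commutator U := by
    rw [← hker, MonoidHom.mem_ker, map_mul, map_inv, hyu, inv_mul_cancel]
  rw [← mul_inv_cancel_left y u]
  exact Subgroup.mul_mem_sup hy h3

/-- A semidirect product is generated by the complement and subsets of the factors as soon as the
invariant subgroups containing them are everything. -/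
theorem SemidirectProduct.closure_eq_top {ι A : Type*} [Finite ι] [DecidableEq ι] [Group A]
    {U : ι → Type*} [∀ i, Group (U i)] {φ : ∀ i, A →* MulAut (U i)} {S : ∀ i, Set (U i)} {T : Set A}
    (hT : Subgroup.closure T = ⊤)
    (hS : ∀ i (H : Subgroup (U i)), S i ⊆ H → (∀ a, ∀ u ∈ H, φ i a u ∈ H) → H = ⊤) :
    Subgroup.closure ((SemidirectProduct.inr : A →* (∀ i, U i) ⋊[piAction φ] A) '' T ∪
      ⋃ i, (fun u => (SemidirectProduct.inl (Pi.mulSingle i u) : (∀ i, U i) ⋊[piAction φ] A)) '' S i)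
      = ⊤ := by
  set X := (SemidirectProduct.inr : A →* (∀ i, U i) ⋊[piAction φ] A) '' T ∪
      ⋃ i, (fun u => (SemidirectProduct.inl (Pi.mulSingle i u) : (∀ i, U i) ⋊[piAction φ] A)) '' S i
    with hX
  have hr : ∀ a : A, SemidirectProduct.inr a ∈ Subgroup.closure X := by
    have : Subgroup.closure T ≤ (Subgroup.closure X).comap SemidirectProduct.inr := by
      rw [Subgroup.closure_le]
      exact fun a ha => Subgroup.subset_closure (Or.inl ⟨a, ha, rfl⟩)
    rw [hT] at this
    exact fun a => this (Subgroup.mem_top a)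
  have hl : ∀ i (u : U i), SemidirectProduct.inl (Pi.mulSingle i u) ∈ Subgroup.closure X := by
    intro i
    have := hS i ((Subgroup.closure X).comap
      ((SemidirectProduct.inl : (∀ i, U i) →* (∀ i, U i) ⋊[piAction φ] A).comp
        (MonoidHom.mulSingle U i)))
      (fun u hu => Subgroup.subset_closure (Or.inr (Set.mem_iUnion.2 ⟨i, u, hu, rfl⟩)))
      (fun a u hu => by
        have e : (SemidirectProduct.inl (Pi.mulSingle i (φ i a u)) : (∀ i, U i) ⋊[piAction φ] A) =
            SemidirectProduct.inr a * SemidirectProduct.inl (Pi.mulSingle i u) *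
              SemidirectProduct.inr a⁻¹ := by
          rw [← SemidirectProduct.inl_aut]
          congr 1
          ext j
          exact (Pi.apply_mulSingle (fun j => φ j a) (fun j => map_one _) i u j).symm
        change SemidirectProduct.inl (Pi.mulSingle i (φ i a u)) ∈ Subgroup.closure X
        rw [e]
        exact mul_mem (mul_mem (hr a) hu) (hr a⁻¹))
    intro u
    have hu := Subgroup.mem_top u
    rw [← this] at hu
    exact hu
  refine (Subgroup.eq_top_iff' _).2 fun g => ?_
  rw [← SemidirectProduct.inl_left_mul_inr_right g]
  refine mul_mem ?_ (hr _)
  exact Subgroup.pi_mem_of_mulSingle_mem (H := (Subgroup.closure X).comap SemidirectProduct.inl) _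
    fun i => hl i _

/-- Generators are a compact generating set of `A` and, in each factor, a compact set whose image in
the abelianization contains a ball. -/
theorem IsStandardSolvable.isCompactlyGeneratedGroup {G : Type v} [Group G] [TopologicalSpace G]
    (hG : IsStandardSolvable.{u, v} G) : IsCompactlyGeneratedGroup G := by
  obtain ⟨D⟩ := hG
  obtain ⟨A, hA, n, K, m, U, hU, φ, -, e, he, r, π, hπc, hπs, hπk, ρ, hπe, hρ⟩ := D
  obtain ⟨T, hTc, hT⟩ := hA
  have hσ := fun i => (hU i).sigmaCompactSpace
  have hnil := fun i => (hU i).isNilpotent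
  choose S hSc ε hε hball using fun i =>
    exists_isCompact_ball_subset_image (hπc i) (hπs i)
  have hgen := SemidirectProduct.closure_eq_top (φ := φ) (S := S) hT fun i H hSH hH =>
    (hρ i).subgroup_eq_top (hπk i) (hπe i) (hε i) hH fun x hx => by
      obtain ⟨u, hu, hux⟩ := hball i x hx
      exact ⟨u, hSH hu, hux⟩
  set X := (SemidirectProduct.inr : A →* (∀ i, U i) ⋊[piAction φ] A) '' T ∪
      ⋃ i, (fun u => (SemidirectProduct.inl (Pi.mulSingle i u) : (∀ i, U i) ⋊[piAction φ] A)) '' S i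
    with hX
  have hXc : IsCompact X := by
    refine IsCompact.union (hTc.image ?_) (isCompact_iUnion fun i => (hSc i).image ?_)
    · exact continuous_induced_rng.2 (continuous_const.prodMk continuous_id)
    · refine continuous_induced_rng.2 (Continuous.prodMk ?_ continuous_const)
      exact continuous_mulSingle (A := fun i => U i) i
  refine ⟨e.symm '' X, hXc.image (?_ : Continuous e.symm), ?_⟩
  · exact (e.toEquiv.isHomeomorph_iff.1 he).2
  have := congrArg (Subgroup.map e.symm.toMonoidHom) hgen
  rw [MonoidHom.map_closure, Subgroup.map_top_of_surjective _ e.symm.surjective] at this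
  exact this

/-- A connected locally compact group is compactly generated. -/
theorem isCompactlyGeneratedGroup_of_connectedSpace {G : Type*} [Group G] [TopologicalSpace G]
    [IsTopologicalGroup G] [LocallyCompactSpace G] [ConnectedSpace G] :
    IsCompactlyGeneratedGroup G := by
  obtain ⟨S, hS, hS1⟩ := exists_compact_mem_nhds (1 : G)
  refine ⟨S, hS, ?_⟩
  have ho : IsOpen (Subgroup.closure S : Set G) :=
    Subgroup.isOpen_of_mem_nhds (g := 1) _ (Filter.mem_of_superset hS1 Subgroup.subset_closure)
  have hc : IsClopen (Subgroup.closure S : Set G) := ⟨Subgroup.isClosed_of_isOpen _ ho, ho⟩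
  exact SetLike.coe_injective (hc.eq_univ ⟨1, Subgroup.one_mem _⟩)

theorem IsRealTriangulable.isCompactlyGeneratedGroup {G : Type*} [Group G] [TopologicalSpace G]
    [IsTopologicalGroup G] [LocallyCompactSpace G] (hG : IsRealTriangulable G) :
    IsCompactlyGeneratedGroup G := by
  obtain ⟨n, H, -, hconn, -, ⟨e⟩⟩ := hG
  have : ConnectedSpace H := isConnected_iff_connectedSpace.1 hconn
  have : ConnectedSpace G := e.symm.toHomeomorph.surjective.connectedSpace e.symm.continuous
  exact isCompactlyGeneratedGroup_of_connectedSpace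

end CompactGeneration

/-! ### Nilpotency of the commutator subgroup. -/

section NilpotentCommutator

theorem Group.isNilpotent_of_injective {N M : Type*} [Group N] [Group M] [Group.IsNilpotent M]
    (F : N →* M) (hF : Function.Injective F) : Group.IsNilpotent N :=
  nilpotent_of_mulEquiv (MonoidHom.ofInjective hF).symm

/-- As `A` is abelian, the commutator subgroup embeds in the product of the `U i`, which is
nilpotent as a finite product. -/
theorem IsStandardSolvable.isNilpotent_commutator {G : Type v} [Group G] [TopologicalSpace G]
    (hG : IsStandardSolvable.{u, v} G) : Group.IsNilpotent (commutator G) := by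
  obtain ⟨D⟩ := hG
  obtain ⟨A, hA, n, K, m, U, hU, φ, -, e, he, r, π, hπc, hπs, hπk, ρ, hπe, hρ⟩ := D
  have hnil := fun i => (hU i).isNilpotent
  have hle : commutator G ≤ ((SemidirectProduct.rightHom :
      (∀ i, U i) ⋊[piAction φ] A →* A).comp e.toMonoidHom).ker :=
    Abelianization.commutator_subset_ker _
  have hright : ∀ g : commutator G, (e g.1).right = 1 := fun g => hle g.2
  let F : commutator G →* ∀ i, U i :=
    { toFun := fun g => (e g.1).left
      map_one' := by simp
      map_mul' := fun g h => by simp [hright g] }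
  refine Group.isNilpotent_of_injective F fun g h hgh => Subtype.ext (e.injective ?_)
  exact SemidirectProduct.ext hgh ((hright g).trans (hright h).symm)

/-- The diagonal entries of upper triangular matrices are multiplicative. -/
def Subgroup.diagonalEntry {R : Type*} [Field R] {n : ℕ}
    (H : Subgroup (Matrix.GeneralLinearGroup (Fin n) R))
    (hH : ∀ g ∈ H, ∀ i j : Fin n, j < i → (g : Matrix (Fin n) (Fin n) R) i j = 0) (i : Fin n) :
    H →* R where
  toFun g := g.1.1 i i
  map_one' := by simp
  map_mul' g h := by
    rw [Subgroup.coe_mul, Units.val_mul, Matrix.mul_apply]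
    refine Finset.sum_eq_single i (fun p _ hp => ?_) fun hi => absurd (Finset.mem_univ i) hi
    rcases lt_or_gt_of_ne hp with h1 | h1
    · rw [hH g g.2 i p h1, zero_mul]
    · rw [hH h h.2 p i h1, mul_zero]

/-- Diagonal entries of triangular matrices are characters, so they are `1` on commutators, which
are therefore unitriangular. -/
theorem IsRealTriangulable.isNilpotent_commutator {G : Type*} [Group G] [TopologicalSpace G]
    (hG : IsRealTriangulable G) : Group.IsNilpotent (commutator G) := by
  obtain ⟨n, H, -, -, htri, ⟨e⟩⟩ := hG
  have hN : Group.IsNilpotent ((commutator H).map H.subtype) := by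
    refine Subgroup.isNilpotent_of_isUnitriangular ?_
    rintro _ ⟨g, hg, rfl⟩ i j hji
    rcases hji.lt_or_eq with h | rfl
    · rw [if_neg h.ne']
      exact htri g g.2 i j h
    · rw [if_pos rfl]
      exact congrArg Units.val
        (Abelianization.commutator_subset_ker (H.diagonalEntry htri j).toHomUnits hg)
  have hmap : ∀ g : commutator G, H.subtype (e g.1) ∈ (commutator H).map H.subtype := by
    intro g
    refine ⟨_, ?_, rfl⟩
    have h1 : commutator G ≤ (commutator H).comap e.toMulEquiv.toMonoidHom := by
      rw [← Subgroup.map_le_iff_le_comap, commutator_def, commutator_def, Subgroup.map_commutator]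
      exact Subgroup.commutator_mono le_top le_top
    exact h1 g.2
  let F : commutator G →* (commutator H).map H.subtype :=
    { toFun := fun g => ⟨_, hmap g⟩
      map_one' := by ext; simp
      map_mul' := fun g h => by ext; simp }
  exact Group.isNilpotent_of_injective F fun g h hgh =>
    Subtype.ext (e.injective (Subtype.ext (congrArg (fun x => x.1) hgh)))

end NilpotentCommutator

theorem mainTheorem5 {G : Type v} [Group G] [TopologicalSpace G] [IsTopologicalGroup G]
    [LocallyCompactSpace G] [T2Space G]
    (hG : IsStandardSolvable.{u, v} G ∨ IsRealTriangulable G) :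
    (HasSOLObstruction.{w, v} G → HasAtLeastExponentialDehnFunction G) ∧
    (HasNonArchimedeanSOLObstruction.{w, v} G → ¬ IsCompactlyPresented G) := by
  have hgen : IsCompactlyGeneratedGroup G :=
    hG.elim (fun h => h.isCompactlyGeneratedGroup) fun h => h.isCompactlyGeneratedGroup
  have hnil : Group.IsNilpotent (commutator G) :=
    hG.elim (fun h => h.isNilpotent_commutator) fun h => h.isNilpotent_commutator
  exact ⟨fun h => ⟨hgen, h.biAsymptoticallyBounded_exp⟩, fun h => h.not_isCompactlyPresented⟩
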